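/- Let $\mathbb{C}_+=\{x+iy : x\in\mathbb{R},\ y>0\}$. Let $\Phi:[0,\infty)\to[0,\infty)$ be an N-function, that is, a continuous, nondecreasing, convex function from $[0,\infty)$ onto itself such that $\Phi(t)=0$ if and only if $t=0$, $\lim_{t\to 0^+}\Phi(t)/t=0$ and $\lim_{t\to\infty}\Phi(t)/t=+\infty$. For measurable $f:\mathbb{R}\to\mathbb{C}$ put $$\|f\|_{L^\Phi}=\inf\Big\{\lambda>0:\ \int_{\mathbb{R}}\Phi\Big(\frac{|f(x)|}{\lambda}\Big)\,dx\le 1\Big\}\in[0,\infty]\qquad(\inf\emptyset=\infty),$$ and let $L^\Phi(\mathbb{R})$ be the set of classes (modulo equality almost everywhere) of measurable $f:\mathbb{R}\to\mathbb{C}$ with $\|f\|_{L^\Phi}<\infty$. Let $h^\Phi(\mathbb{C}_+)$ be the set of harmonic functions $F:\mathbb{C}_+\to\mathbb{C}$ with $$\|F\|_{h^\Phi}=\sup_{y>0}\|F(\cdot+iy)\|_{L^\Phi}<\infty.$$ Let $F:\mathbb{C}_+\to\mathbb{C}$ be harmonic. Then the following are equivalent: (i) $F\in h^\Phi(\mathbb{C}_+)$;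 (ii) there exists a unique $f\in L^\Phi(\mathbb{R})$ such that, for all $x\in\mathbb{R}$ and $y>0$, $$F(x+iy)=\frac1\pi\int_{\mathbb{R}}\frac{y}{(x-t)^2+y^2}\,f(t)\,dt,$$ where the integral converges absolutely. Moreover, whenever $f\in L^\Phi(\mathbb{R})$ satisfies the formula in (ii), $$\|F\|_{h^\Phi}=\lim_{y\to0^+}\|F(\cdot+iy)\|_{L^\Phi}=\|f\|_{L^\Phi}.$$ -/

import Mathlib

open MeasureTheory Filter Topology
open scoped ENNReal

noncomputable section

namespace HardyOrlicz

/-- A growth function: a continuous nondecreasing map of `[0, ∞)` onto itself. Only the values of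
`Φ : ℝ → ℝ` on `[0, ∞)` matter. -/
structure IsGrowthFunction (Φ : ℝ → ℝ) : Prop where
  continuousOn : ContinuousOn Φ (Set.Ici 0)
  monotoneOn : MonotoneOn Φ (Set.Ici 0)
  image_eq : Φ '' Set.Ici 0 = Set.Ici 0

/-- An N-function: a convex growth function vanishing only at `0`, with `Φ(t)/t → 0` as `t → 0`
and `Φ(t)/t → ∞` as `t → ∞`. -/
structure IsNFunction (Φ : ℝ → ℝ) : Prop extends IsGrowthFunction Φ where
  convexOn : ConvexOn ℝ (Set.Ici 0) Φ
  eq_zero_iff : ∀ t, 0 ≤ t → (Φ t = 0 ↔ t = 0)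
  tendsto_zero : Tendsto (fun t => Φ t / t) (𝓝[>] 0) (𝓝 0)
  tendsto_atTop : Tendsto (fun t => Φ t / t) atTop atTop

/-- The Luxemburg norm
`inf {r > 0 : ∫ Φ(|f(x)| / r) dx ≤ 1}`, with values in `[0, ∞]` (the infimum of `∅` is `∞`). -/
def luxNorm (Φ : ℝ → ℝ) (f : ℝ → ℂ) : ℝ≥0∞ :=
  ⨅ (r : ℝ) (_ : 0 < r) (_ : ∫⁻ x, ENNReal.ofReal (Φ (‖f x‖ / r)) ≤ 1), ENNReal.ofReal r

/-- The Orlicz space `L^Φ(ℝ)`, a set of a.e.-classes of measurable functions `ℝ → ℂ`. -/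
def orliczSpace (Φ : ℝ → ℝ) : Set (ℝ →ₘ[volume] ℂ) :=
  {f | luxNorm Φ f < ∞}

/-- The function `x ↦ F(x + iy)`. -/
def horizontalSlice (F : ℂ → ℂ) (y : ℝ) : ℝ → ℂ := fun x => F (x + y * Complex.I)

/-- The norm of `h^Φ(ℂ₊)`: `sup_{y > 0} ‖F(· + iy)‖_{L^Φ}`, with values in `[0, ∞]`. -/
def hardyNorm (Φ : ℝ → ℝ) (F : ℂ → ℂ) : ℝ≥0∞ :=
  ⨆ (y : ℝ) (_ : 0 < y), luxNorm Φ (horizontalSlice F y)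

/-- The Hardy-Orlicz space `h^Φ(ℂ₊)` of functions harmonic on the open upper half-plane with finite
norm. Such functions are represented by maps `ℂ → ℂ` whose values off the half-plane are
irrelevant. -/
def hardyOrliczSpace (Φ : ℝ → ℝ) : Set (ℂ → ℂ) :=
  {F | InnerProductSpace.HarmonicOnNhd F {z : ℂ | 0 < z.im} ∧ hardyNorm Φ F < ∞}

/-- The Poisson kernel `P_y(s) = (1/π) · y / (s² + y²)` of the upper half-plane. -/
def halfPlanePoisson (y s : ℝ) : ℝ := 1 / Real.pi * (y / (s ^ 2 + y ^ 2))

/-- `F` is the Poisson integral of `f` on the upper half-plane: at every point the integral exists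
(absolutely) and is equal to the value of `F`. -/
def IsPoissonIntegral (f : ℝ → ℂ) (F : ℂ → ℂ) : Prop :=
  ∀ x y : ℝ, 0 < y →
    Integrable (fun t => (halfPlanePoisson y (x - t) : ℂ) * f t) ∧
    F (x + y * Complex.I) = ∫ t, (halfPlanePoisson y (x - t) : ℂ) * f t

end HardyOrlicz

end

/-!
If `F` is the Poisson integral of `f`, each slice `F(· + iy)` is an average of translates of `f`
against a probability density, so Jensen's inequality for `Φ` and Tonelli's theorem give
`‖F(· + iy)‖ ≤ ‖f‖` in the Luxemburg norm (`IsPoissonIntegral.luxNorm_horizontalSlice_le`).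
Conversely, `F(· + iy) → f` in `L¹` of harmonic measure at `i`, a finite measure equivalent to
Lebesgue measure (`tendsto_lintegral_enorm_integral_harmonicMeasure_sub`): Poisson averaging is
bounded on that space because `P_y * P_1 = P_{1+y}`, and convergence is clear for bounded continuous
functions. Hence `f` is determined by `F`, and an almost everywhere convergent subsequence with
Fatou's lemma gives `‖f‖ ≤ liminf ‖F(· + iy)‖` (`IsPoissonIntegral.luxNorm_le_of_frequently`). This
settles the norm identities, uniqueness, and the implication from (ii) to (i).

It remains to represent `F ∈ h^Φ` as a Poisson integral (`exists_isPoissonIntegral`). The mean value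
inequality over discs and the bound on the modulars show that `F` is bounded on every half-plane
`{Im z ≥ δ}` (`exists_bound_of_lintegral_le`). A bounded harmonic function is the Poisson integral
of its values on the boundary line (`eq_integral_halfPlanePoisson_of_bounded`), by a maximum
principle with a logarithmic comparison function, so `F(x + i(y + δ)) = (P_y * F(· + iδ))(x)`. Since
`Φ(t)/t → ∞`, the slices `F(· + iδ)` are uniformly integrable with respect to harmonic measure, and
they converge weakly in `L¹`, along an ultrafilter of heights `δ → 0`, to some `f`: the limits of
their integrals over measurable sets form a signed measure, to which the Radon–Nikodym theorem
applies (`exists_tendsto_integral_smul`). Testing against the ratio of two Poisson kernels, which is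
bounded, gives `F = P[f]`.
-/

noncomputable section

namespace HardyOrlicz

/-! ### The Poisson kernel of the half-plane -/

lemma halfPlanePoisson_pos {y : ℝ} (hy : 0 < y) (s : ℝ) : 0 < halfPlanePoisson y s := by
  unfold halfPlanePoisson
  have := Real.pi_pos
  positivity

@[fun_prop]
lemma measurable_halfPlanePoisson {α : Type*} [MeasurableSpace α] {u v : α → ℝ}
    (hu : Measurable u) (hv : Measurable v) :
    Measurable fun a => halfPlanePoisson (u a) (v a) := by
  unfold halfPlanePoisson
  fun_prop

lemma halfPlanePoisson_eq_cauchyPDFReal {y : ℝ} (hy : 0 < y) (x t : ℝ) :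
    halfPlanePoisson y (x - t) = ProbabilityTheory.cauchyPDFReal x y.toNNReal t := by
  rw [halfPlanePoisson, ProbabilityTheory.cauchyPDFReal_def, Real.coe_toNNReal y hy.le,
    ← neg_sub t x, neg_sq]
  simp only [div_eq_mul_inv, one_mul, mul_assoc]

lemma integrable_halfPlanePoisson {y : ℝ} (hy : 0 < y) (x : ℝ) :
    Integrable fun t => halfPlanePoisson y (x - t) := by
  simp_rw [halfPlanePoisson_eq_cauchyPDFReal hy]
  exact ProbabilityTheory.integrable_cauchyPDFReal x

lemma integral_halfPlanePoisson {y : ℝ} (hy : 0 < y) (x : ℝ) :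
    ∫ t, halfPlanePoisson y (x - t) = 1 := by
  simp_rw [halfPlanePoisson_eq_cauchyPDFReal hy]
  exact ProbabilityTheory.integral_cauchyPDFReal_eq_one x (Real.toNNReal_pos.2 hy).ne'

lemma halfPlanePoisson_neg (y s : ℝ) : halfPlanePoisson y (-s) = halfPlanePoisson y s := by
  simp [halfPlanePoisson]

lemma integrable_halfPlanePoisson_one : Integrable (halfPlanePoisson 1) := by
  simpa [halfPlanePoisson_neg] using integrable_halfPlanePoisson one_pos 0

lemma integral_halfPlanePoisson_one : ∫ s, halfPlanePoisson 1 s = 1 := by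
  simpa [halfPlanePoisson_neg] using integral_halfPlanePoisson one_pos 0

lemma lintegral_halfPlanePoisson {y : ℝ} (hy : 0 < y) (x : ℝ) :
    ∫⁻ t, ENNReal.ofReal (halfPlanePoisson y (x - t)) = 1 := by
  rw [← ofReal_integral_eq_lintegral_ofReal (integrable_halfPlanePoisson hy x)
    (ae_of_all _ fun t => (halfPlanePoisson_pos hy _).le), integral_halfPlanePoisson hy,
    ENNReal.ofReal_one]

lemma halfPlanePoisson_le {y : ℝ} (hy : 0 < y) (s : ℝ) :
    halfPlanePoisson y s ≤ 1 / (Real.pi * y) := by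
  have := Real.pi_pos
  unfold halfPlanePoisson
  rw [div_mul_div_comm, one_mul, div_le_div_iff₀ (by positivity) (by positivity)]
  nlinarith [mul_nonneg Real.pi_pos.le (sq_nonneg s)]

/-- For `x + iy` in a compact part of the half-plane, the kernel with pole there is dominated by
a multiple of the kernel with pole `i`. -/
lemma halfPlanePoisson_le_mul_one {δ R x y : ℝ} (hδ : 0 < δ) (hx : |x| ≤ R) (hy : δ ≤ y)
    (hyR : y ≤ R) (t : ℝ) :
    halfPlanePoisson y (x - t) ≤ R * (2 + (2 * R ^ 2 + 1) / δ ^ 2) * halfPlanePoisson 1 t := by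
  have hpi := Real.pi_pos
  have hy0 : 0 < y := hδ.trans_le hy
  have hxR : x ^ 2 ≤ R ^ 2 := sq_le_sq' (by linarith [neg_abs_le x]) ((le_abs_self x).trans hx)
  have h1 : t ^ 2 + 1 ≤ (2 + (2 * R ^ 2 + 1) / δ ^ 2) * ((x - t) ^ 2 + y ^ 2) := by
    have h2 : 2 * R ^ 2 + 1 ≤ (2 * R ^ 2 + 1) / δ ^ 2 * ((x - t) ^ 2 + y ^ 2) := by
      rw [div_mul_eq_mul_div, le_div_iff₀ (by positivity)]
      have : δ ^ 2 ≤ y ^ 2 := pow_le_pow_left₀ hδ.le hy 2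
      gcongr
      nlinarith [sq_nonneg (x - t)]
    nlinarith [sq_nonneg (2 * x - t), sq_nonneg y]
  unfold halfPlanePoisson
  rw [mul_left_comm]
  gcongr
  rw [mul_one_div, div_le_div_iff₀ (by positivity) (by positivity), one_pow, mul_assoc]
  exact mul_le_mul hyR h1 (by positivity) (hy0.le.trans hyR)

lemma halfPlanePoisson_one_add_le {y : ℝ} (hy : 0 < y) (s : ℝ) :
    halfPlanePoisson (1 + y) s ≤ (1 + y) * halfPlanePoisson 1 s := by
  have := Real.pi_pos
  unfold halfPlanePoisson
  rw [mul_left_comm, mul_one_div]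
  gcongr
  nlinarith

/-- The Poisson kernel is the imaginary part of the holomorphic function `z ↦ -1/(π (z - t))`. -/
lemma harmonicOnNhd_halfPlanePoisson (t : ℝ) :
    InnerProductSpace.HarmonicOnNhd (fun z : ℂ => halfPlanePoisson z.im (z.re - t))
      {z : ℂ | 0 < z.im} := by
  intro z hz
  have hne : z - t ≠ 0 := fun h => by
    have := congrArg Complex.im h
    simp at this
    exact (ne_of_gt hz) this
  have h : AnalyticAt ℂ (fun z : ℂ => -(Real.pi : ℂ)⁻¹ * (z - t)⁻¹) z := by
    fun_prop (disch := assumption)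
  convert h.harmonicAt_im using 2 with w
  rw [← Complex.ofReal_inv, ← Complex.ofReal_neg, Complex.im_ofReal_mul, Complex.inv_im,
    Complex.normSq_apply, halfPlanePoisson]
  simp
  ring

/-- The Poisson average of `g` at `x + iy`, rescaled to the kernel with pole `i`. -/
lemma integral_halfPlanePoisson_smul_comp {E : Type*} [NormedAddCommGroup E] [NormedSpace ℝ E]
    {y : ℝ} (hy : 0 < y) (x : ℝ) (g : ℝ → E) :
    ∫ t, halfPlanePoisson y (x - t) • g t = ∫ s, halfPlanePoisson 1 s • g (x - y * s) := by
  have h1 : ∀ s, halfPlanePoisson 1 s • g (x - y * s) =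
      y • (fun u => halfPlanePoisson y u • g (x - u)) (y * s) := fun s => by
    simp only [smul_smul]
    congr 1
    unfold halfPlanePoisson
    field_simp
  simp_rw [h1]
  rw [integral_smul, Measure.integral_comp_mul_left (fun u => halfPlanePoisson y u • g (x - u)),
    smul_smul, abs_of_pos (inv_pos.2 hy), mul_inv_cancel₀ hy.ne', one_smul,
    ← integral_sub_left_eq_self _ volume x]
  simp

/-! ### Bounded harmonic functions are Poisson integrals of their boundary values -/

/-- A closed disc of radius smaller than the height of its centre lies in the half-plane. -/
lemma closedBall_subset_halfPlane {z : ℂ} {ρ : ℝ} (hρ : ρ < z.im) :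
    Metric.closedBall z ρ ⊆ {w : ℂ | 0 < w.im} := by
  intro w hw
  have h1 := (Complex.abs_im_le_norm (w - z)).trans (mem_closedBall_iff_norm.1 hw)
  rw [Complex.sub_im] at h1
  have := (abs_le.1 h1).1
  simp only [Set.mem_ofPred_eq]
  linarith

lemma sphere_subset_closedHalfPlane {z : ℂ} {ρ : ℝ} (hρ : ρ < z.im) :
    Metric.sphere z ρ ⊆ {w : ℂ | 0 ≤ w.im} := fun w hw => by
  have : 0 < w.im := closedBall_subset_halfPlane hρ (Metric.sphere_subset_closedBall hw)
  exact this.le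

lemma circleAverage_eq_of_harmonicOnNhd {E : Type*} [NormedAddCommGroup E] [NormedSpace ℝ E]
    [CompleteSpace E] {F : ℂ → E}
    (hF : InnerProductSpace.HarmonicOnNhd F {z : ℂ | 0 < z.im}) {z : ℂ} {ρ : ℝ} (hρ0 : 0 < ρ)
    (hρ : ρ < z.im) : Real.circleAverage F z ρ = F z := by
  apply InnerProductSpace.HarmonicOnNhd.circleAverage_eq
  rw [abs_of_pos hρ0]
  exact hF.mono (closedBall_subset_halfPlane hρ)

/-- A continuous function on a circle attaining its maximum as its average is constant there. -/
lemma eq_of_circleAverage_eq {h : ℂ → ℝ} {z w : ℂ} {ρ m : ℝ} (hρ : 0 < ρ)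
    (hc : ContinuousOn h (Metric.sphere z ρ)) (hle : ∀ w ∈ Metric.sphere z ρ, h w ≤ m)
    (hm : Real.circleAverage h z ρ = m) (hw : w ∈ Metric.sphere z ρ) : h w = m := by
  by_contra hne
  have hlt : h w < m := lt_of_le_of_ne (hle w hw) hne
  have hpi := Real.two_pi_pos
  obtain ⟨θ, hθ, rfl⟩ : w ∈ circleMap z ρ '' Set.Ioc 0 (2 * Real.pi) := by
    rw [image_circleMap_Ioc, abs_of_pos hρ]; exact hw
  have hmem : ∀ θ, circleMap z ρ θ ∈ Metric.sphere z ρ := circleMap_mem_sphere z hρ.le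
  have hcont : Continuous fun θ => h (circleMap z ρ θ) :=
    hc.comp_continuous (continuous_circleMap z ρ) hmem
  have := intervalIntegral.integral_lt_integral_of_continuousOn_of_le_of_exists_lt hpi
    hcont.continuousOn (continuousOn_const (c := m)) (fun θ _ => hle _ (hmem θ))
    ⟨θ, ⟨hθ.1.le, hθ.2⟩, hlt⟩
  rw [intervalIntegral.integral_const, sub_zero, smul_eq_mul] at this
  rw [Real.circleAverage_def, smul_eq_mul, inv_mul_eq_iff_eq_mul₀ hpi.ne'] at hm
  exact this.ne hm

/-- Maximum principle on the half-plane. The comparison function `ε log |z + 2i|` is harmonic,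
nonnegative and tends to infinity. -/
theorem nonpos_of_circleAverage_eq {u : ℂ → ℝ} {B : ℝ} (hc : ContinuousOn u {z : ℂ | 0 ≤ z.im})
    (hb : ∀ z : ℂ, 0 ≤ z.im → u z ≤ B)
    (hm : ∀ (z : ℂ) (ρ : ℝ), 0 < ρ → ρ < z.im → Real.circleAverage u z ρ = u z)
    (h0 : ∀ z : ℂ, z.im = 0 → u z ≤ 0) {z₀ : ℂ} (hz₀ : 0 ≤ z₀.im) : u z₀ ≤ 0 := by
  by_contra! hpos
  set v : ℂ → ℝ := fun z => Real.log ‖z + 2 * Complex.I‖ with hv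
  have hnorm : ∀ z : ℂ, 0 ≤ z.im → 2 ≤ ‖z + 2 * Complex.I‖ := fun z hz => by
    have := (le_abs_self _).trans (Complex.abs_im_le_norm (z + 2 * Complex.I))
    simp at this
    linarith
  have hne : ∀ z : ℂ, 0 ≤ z.im → z + 2 * Complex.I ≠ 0 := fun z hz h => by
    have := hnorm z hz
    simp [h] at this
    linarith
  have hvpos : ∀ z : ℂ, 0 ≤ z.im → 0 < v z := fun z hz =>
    Real.log_pos (by linarith [hnorm z hz])
  have hvc : ContinuousOn v {z : ℂ | 0 ≤ z.im} := by
    refine ContinuousOn.log (by fun_prop) fun z hz => ?_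
    exact norm_ne_zero_iff.2 (hne z hz)
  have hvh : InnerProductSpace.HarmonicOnNhd v {z : ℂ | 0 < z.im} := fun z hz =>
    AnalyticAt.harmonicAt_log_norm (by fun_prop) (hne z (le_of_lt hz))
  obtain ⟨ε, hε, hεz⟩ : ∃ ε, 0 < ε ∧ ε * v z₀ < u z₀ :=
    ⟨u z₀ / (2 * v z₀), by have := hvpos z₀ hz₀; positivity, by
      have := hvpos z₀ hz₀
      rw [div_mul_eq_mul_div, mul_comm 2, ← div_div, mul_div_cancel_right₀ _ this.ne']
      linarith⟩
  -- `h` is still positive at `z₀`, and negative far out because `v` tends to infinity.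
  set h : ℂ → ℝ := fun z => u z - ε * v z with hh
  have hhc : ContinuousOn h {z : ℂ | 0 ≤ z.im} := hc.sub (hvc.const_smul ε)
  have hfar : ∃ R, ∀ z : ℂ, 0 ≤ z.im → R < ‖z‖ → h z < 0 := by
    refine ⟨Real.exp (B / ε) + 2, fun z hz hR => ?_⟩
    have h1 : Real.exp (B / ε) < ‖z + 2 * Complex.I‖ := by
      have := norm_sub_le (z + 2 * Complex.I) (2 * Complex.I)
      simp at this
      linarith
    have h2 : B / ε < v z := (Real.lt_log_iff_exp_lt (by linarith [hnorm z hz])).2 h1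
    rw [div_lt_iff₀' hε] at h2
    have := hb z hz
    simp only [hh]
    linarith
  obtain ⟨R, hR⟩ := hfar
  set K : Set ℂ := {z : ℂ | 0 ≤ z.im} ∩ Metric.closedBall 0 R with hK
  have hcl : IsClosed {z : ℂ | 0 ≤ z.im} := isClosed_le continuous_const Complex.continuous_im
  have hKc : IsCompact K := (isCompact_closedBall 0 R).inter_left hcl
  have hmemK : ∀ z : ℂ, 0 ≤ z.im → 0 ≤ h z → z ∈ K := fun z hz hz' =>
    ⟨hz, by
      rw [mem_closedBall_zero_iff]
      by_contra! hlt
      exact absurd (hR z hz hlt) (not_lt.2 hz')⟩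
  have hz₀h : 0 < h z₀ := sub_pos.2 hεz
  obtain ⟨z₁, hz₁, hmax⟩ := hKc.exists_isMaxOn ⟨z₀, hmemK z₀ hz₀ hz₀h.le⟩
    (hhc.mono Set.inter_subset_left)
  have hm0 : 0 < h z₁ := hz₀h.trans_le (hmax (hmemK z₀ hz₀ hz₀h.le))
  have hmax' : ∀ z : ℂ, 0 ≤ z.im → h z ≤ h z₁ := fun z hz => by
    by_cases hz' : 0 ≤ h z
    · exact hmax (hmemK z hz hz')
    · linarith
  -- Among the maximum points of `h`, take one with minimal imaginary part: `h` is constant on a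
  -- small circle about it, whose lowest point is then a maximum point lying lower still.
  have hSc : IsCompact (K ∩ h ⁻¹' {h z₁}) :=
    hKc.of_isClosed_subset ((hhc.mono Set.inter_subset_left).preimage_isClosed_of_isClosed
      hKc.isClosed isClosed_singleton) Set.inter_subset_left
  obtain ⟨z₂, hz₂, hmin⟩ := hSc.exists_isMinOn ⟨z₁, hz₁, rfl⟩ Complex.continuous_im.continuousOn
  have hz₂h : h z₂ = h z₁ := hz₂.2
  have hz₂im : 0 < z₂.im := by
    refine lt_of_le_of_ne hz₂.1.1 fun h' => ?_
    have h1 := h0 z₂ h'.symm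
    have h2 := mul_pos hε (hvpos z₂ hz₂.1.1)
    have h3 : h z₂ = u z₂ - ε * v z₂ := rfl
    linarith
  set ρ := z₂.im / 2 with hρ
  have hρ0 : 0 < ρ := half_pos hz₂im
  have hρ1 : ρ < z₂.im := half_lt_self hz₂im
  have hsub : Metric.sphere z₂ ρ ⊆ {z : ℂ | 0 ≤ z.im} := sphere_subset_closedHalfPlane hρ1
  have hw : z₂ - ρ * Complex.I ∈ Metric.sphere z₂ ρ := by
    simp [abs_of_pos hρ0]
  have havg : Real.circleAverage h z₂ ρ = h z₁ := by
    have hcu : CircleIntegrable u z₂ ρ :=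
      ContinuousOn.circleIntegrable hρ0.le (hc.mono hsub)
    have hcv : CircleIntegrable (ε • v) z₂ ρ :=
      ContinuousOn.circleIntegrable hρ0.le ((hvc.mono hsub).const_smul ε)
    have : h = u - ε • v := rfl
    rw [← hz₂h, this, Real.circleAverage_sub hcu hcv, Real.circleAverage_smul, hm z₂ ρ hρ0 hρ1,
      circleAverage_eq_of_harmonicOnNhd hvh hρ0 hρ1]
    rfl
  have heq := eq_of_circleAverage_eq hρ0 (hhc.mono hsub) (fun w hw => hmax' w (hsub hw)) havg hw
  have := hmin ⟨hmemK _ (hsub hw) (by rw [heq]; exact hm0.le), heq⟩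
  simp at this
  linarith

/-- Uniqueness for the bounded Dirichlet problem, stated through the mean value property so that it
applies to Poisson extensions without a proof that these are twice differentiable. -/
theorem eq_zero_of_circleAverage_eq {G : ℂ → ℂ} {B : ℝ}
    (hc : ContinuousOn G {z : ℂ | 0 ≤ z.im}) (hb : ∀ z : ℂ, 0 ≤ z.im → ‖G z‖ ≤ B)
    (hm : ∀ (z : ℂ) (ρ : ℝ), 0 < ρ → ρ < z.im → Real.circleAverage G z ρ = G z)
    (h0 : ∀ z : ℂ, z.im = 0 → G z = 0) {z₀ : ℂ} (hz₀ : 0 ≤ z₀.im) : G z₀ = 0 := by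
  have key : ∀ L : ℂ →L[ℝ] ℝ, L (G z₀) ≤ 0 := fun L => by
    refine nonpos_of_circleAverage_eq (u := fun z => L (G z)) (B := ‖L‖ * B)
      (L.continuous.comp_continuousOn hc) (fun z hz => ?_) (fun z ρ hρ hρz => ?_) (fun z hz => ?_)
      hz₀
    · exact (le_abs_self _).trans ((L.le_opNorm _).trans
        (mul_le_mul_of_nonneg_left (hb z hz) (norm_nonneg _)))
    · have hci : CircleIntegrable G z ρ :=
        ContinuousOn.circleIntegrable hρ.le
          (hc.mono (sphere_subset_closedHalfPlane hρz))
      have := L.circleAverage_comp_comm hci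
      rw [hm z ρ hρ hρz] at this
      exact this
    · simp [h0 z hz]
  apply Complex.ext
  · exact le_antisymm (key Complex.reCLM) (by simpa using key (-Complex.reCLM))
  · exact le_antisymm (key Complex.imCLM) (by simpa using key (-Complex.imCLM))

/-- The Poisson extension of a bounded continuous function, in the form which makes sense and is
continuous up to the real line. -/
lemma continuous_integral_halfPlanePoisson_smul {g : ℝ → ℂ} {B : ℝ} (hg : Continuous g)
    (hB : ∀ t, ‖g t‖ ≤ B) :
    Continuous fun p : ℝ × ℝ => ∫ s, halfPlanePoisson 1 s • g (p.1 - p.2 * s) := by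
  refine continuous_of_dominated (bound := fun s => halfPlanePoisson 1 s * B) (fun p => ?_)
    (fun p => ae_of_all _ fun s => ?_) (integrable_halfPlanePoisson_one.mul_const B)
    (ae_of_all _ fun s => by fun_prop)
  · refine AEStronglyMeasurable.smul integrable_halfPlanePoisson_one.aestronglyMeasurable ?_
    exact (hg.comp (by fun_prop)).aestronglyMeasurable
  · rw [norm_smul, Real.norm_of_nonneg (halfPlanePoisson_pos one_pos s).le]
    exact mul_le_mul_of_nonneg_left (hB _) (halfPlanePoisson_pos one_pos s).le

lemma norm_integral_halfPlanePoisson_smul_le {g : ℝ → ℂ} {B : ℝ} (hB : ∀ t, ‖g t‖ ≤ B) (a b : ℝ) :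
    ‖∫ s, halfPlanePoisson 1 s • g (a - b * s)‖ ≤ B := by
  calc ‖∫ s, halfPlanePoisson 1 s • g (a - b * s)‖
      ≤ ∫ s, halfPlanePoisson 1 s * B :=
        norm_integral_le_of_norm_le (integrable_halfPlanePoisson_one.mul_const B)
          (ae_of_all _ fun s => by
            rw [norm_smul, Real.norm_of_nonneg (halfPlanePoisson_pos one_pos s).le]
            exact mul_le_mul_of_nonneg_left (hB _) (halfPlanePoisson_pos one_pos s).le)
    _ = B := by rw [integral_mul_const, integral_halfPlanePoisson_one, one_mul]

/-- The Poisson extension of a bounded continuous function has the mean value property, since each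
kernel does; the interchange of integrals uses that on a circle inside the half-plane the kernels
are dominated by a multiple of the kernel with pole `i`. -/
lemma circleAverage_integral_halfPlanePoisson_smul {g : ℝ → ℂ} {B : ℝ} (hg : Continuous g)
    (hB : ∀ t, ‖g t‖ ≤ B) {z : ℂ} {ρ : ℝ} (hρ0 : 0 < ρ) (hρ : ρ < z.im) :
    Real.circleAverage (fun w : ℂ => ∫ t, halfPlanePoisson w.im (w.re - t) • g t) z ρ =
      ∫ t, halfPlanePoisson z.im (z.re - t) • g t := by
  have hmem : ∀ θ, circleMap z ρ θ ∈ Metric.closedBall z ρ :=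
    circleMap_mem_closedBall z hρ0.le
  have hprod : Integrable (Function.uncurry fun (θ t : ℝ) =>
      halfPlanePoisson (circleMap z ρ θ).im ((circleMap z ρ θ).re - t) • g t)
      ((volume.restrict (Set.uIoc 0 (2 * Real.pi))).prod volume) := by
    have : IsFiniteMeasure (volume.restrict (Set.uIoc 0 (2 * Real.pi))) := by
      rw [Set.uIoc_of_le Real.two_pi_pos.le]
      infer_instance
    set R := ‖z‖ + ρ
    set δ := z.im - ρ
    set C := R * (2 + (2 * R ^ 2 + 1) / δ ^ 2)
    have hbd : Integrable (fun t => C * halfPlanePoisson 1 t * B) :=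
      (integrable_halfPlanePoisson_one.const_mul C).mul_const B
    refine (hbd.comp_snd (volume.restrict (Set.uIoc 0 (2 * Real.pi)))).mono'
      (g := fun p : ℝ × ℝ => C * halfPlanePoisson 1 p.2 * B) ?_ (ae_of_all _ fun p => ?_)
    · have h1 : Measurable fun p : ℝ × ℝ => halfPlanePoisson (circleMap z ρ p.1).im
          ((circleMap z ρ p.1).re - p.2) := by
        have := (continuous_circleMap z ρ).measurable
        fun_prop
      have h2 : Continuous fun p : ℝ × ℝ => g p.2 := hg.comp continuous_snd
      exact (h1.smul h2.measurable).aestronglyMeasurable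
    · set w := circleMap z ρ p.1 with hw
      have hwz := mem_closedBall_iff_norm.1 (hmem p.1)
      have h1 : ‖w‖ ≤ R := by
        have := norm_add_le z (w - z)
        rw [add_sub_cancel] at this
        linarith
      have h2 : δ ≤ w.im := by
        have := (abs_le.1 ((Complex.abs_im_le_norm (w - z)).trans hwz)).1
        rw [Complex.sub_im] at this
        simp only [δ]; linarith
      have hδ : 0 < δ := sub_pos.2 hρ
      rw [Function.uncurry, norm_smul,
        Real.norm_of_nonneg (halfPlanePoisson_pos (hδ.trans_le h2) _).le]
      exact mul_le_mul (halfPlanePoisson_le_mul_one hδ ((Complex.abs_re_le_norm w).trans h1) h2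
        ((le_abs_self _).trans ((Complex.abs_im_le_norm w).trans h1)) p.2) (hB _) (norm_nonneg _)
        (mul_nonneg (by positivity) (halfPlanePoisson_pos one_pos _).le)
  rw [Real.circleAverage_def, intervalIntegral_integral_swap hprod, ← integral_smul]
  congr 1 with t : 1
  rw [intervalIntegral.integral_smul_const, ← smul_assoc]
  congr 1
  exact circleAverage_eq_of_harmonicOnNhd (harmonicOnNhd_halfPlanePoisson t) hρ0 hρ

/-- A harmonic function on the half-plane that is bounded on `{Im z ≥ δ}` is there the Poisson
integral of its values on the line `Im z = δ`. -/
theorem eq_integral_halfPlanePoisson_of_bounded {F : ℂ → ℂ} {δ B : ℝ}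
    (hF : InnerProductSpace.HarmonicOnNhd F {z : ℂ | 0 < z.im}) (hδ : 0 < δ)
    (hB : ∀ z : ℂ, δ ≤ z.im → ‖F z‖ ≤ B) {x y : ℝ} (hy : 0 < y) :
    F (x + (y + δ : ℝ) * Complex.I) =
      ∫ t, halfPlanePoisson y (x - t) • horizontalSlice F δ t := by
  set g := horizontalSlice F δ with hgdef
  have hgB : ∀ t, ‖g t‖ ≤ B := fun t => hB _ (by simp)
  have hFc : ContinuousOn F {z : ℂ | 0 < z.im} := hF.contDiffOn.continuousOn
  have hg : Continuous g := hFc.comp_continuous (by fun_prop) (fun t => by simpa using hδ)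
  have hshift : ContinuousOn (fun z : ℂ => F (z + δ * Complex.I)) {z : ℂ | 0 ≤ z.im} :=
    hFc.comp (by fun_prop) fun z (hz : 0 ≤ z.im) => by
      simp only [Set.mem_ofPred_eq, Complex.add_im, Complex.mul_I_im, Complex.ofReal_re]
      positivity
  -- `H` is the Poisson extension of `g`, written so as to be defined on the real line too.
  set H : ℂ → ℂ := fun z => ∫ s, halfPlanePoisson 1 s • g (z.re - z.im * s) with hH
  have hHc : Continuous H := (continuous_integral_halfPlanePoisson_smul hg hgB).comp
    (Complex.continuous_re.prodMk Complex.continuous_im)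
  have hH' : ∀ z : ℂ, 0 < z.im → H z = ∫ t, halfPlanePoisson z.im (z.re - t) • g t :=
    fun z hz => (integral_halfPlanePoisson_smul_comp hz z.re g).symm
  have hzero := eq_zero_of_circleAverage_eq (G := fun z => F (z + δ * Complex.I) - H z)
    (B := B + B) (z₀ := x + y * Complex.I) (hshift.sub hHc.continuousOn) (fun z hz => ?_)
    (fun z ρ hρ0 hρ => ?_) (fun z hz => ?_) (by simpa using hy.le)
  · rw [sub_eq_zero, hH' _ (by simpa using hy)] at hzero
    simp only [Complex.add_im, Complex.mul_I_im, Complex.ofReal_re, Complex.ofReal_im, zero_add,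
      Complex.add_re, Complex.mul_I_re, neg_zero, add_zero] at hzero
    rw [← hzero]
    congr 1
    push_cast
    ring
  · refine (norm_sub_le _ _).trans (add_le_add (hB _ (by simpa using hz)) ?_)
    exact norm_integral_halfPlanePoisson_smul_le hgB z.re z.im
  · have hsub : Metric.sphere z ρ ⊆ {w : ℂ | 0 < w.im} :=
      Metric.sphere_subset_closedBall.trans (closedBall_subset_halfPlane hρ)
    have hc1 : CircleIntegrable (fun z : ℂ => F (z + δ * Complex.I)) z ρ :=
      ContinuousOn.circleIntegrable hρ0.le
        (hshift.mono (sphere_subset_closedHalfPlane hρ))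
    have hc2 : CircleIntegrable H z ρ :=
      ContinuousOn.circleIntegrable hρ0.le hHc.continuousOn
    have e1 : Real.circleAverage (fun z : ℂ => F (z + δ * Complex.I)) z ρ =
        F (z + δ * Complex.I) := by
      rw [← circleAverage_eq_of_harmonicOnNhd hF hρ0 (z := z + δ * Complex.I)
        (by simp; linarith)]
      simp only [Real.circleAverage_def, circleMap]
      congr 2 with θ
      congr 1
      ring
    have e2 : Real.circleAverage H z ρ = H z := by
      rw [hH' z (hρ0.trans hρ), ← circleAverage_integral_halfPlanePoisson_smul hg hgB hρ0 hρ]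
      refine Real.circleAverage_congr_sphere fun w hw => hH' w (hsub ?_)
      rwa [abs_of_pos hρ0] at hw
    rw [Real.circleAverage_fun_sub hc1 hc2, e1, e2]
  · have e : H z = g z.re := by
      simp only [hH, hz, zero_mul, sub_zero]
      rw [integral_smul_const, integral_halfPlanePoisson_one, one_smul]
    rw [e, sub_eq_zero, hgdef, horizontalSlice]
    congr 2
    apply Complex.ext <;> simp [hz]

/-- Semigroup property of the Poisson kernel: the bounded harmonic function `z ↦ P_{Im z + 1}(Re z)`
is the Poisson integral of its boundary values. -/
lemma integral_halfPlanePoisson_mul {y : ℝ} (hy : 0 < y) (x : ℝ) :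
    ∫ t, halfPlanePoisson y (x - t) * halfPlanePoisson 1 t = halfPlanePoisson (y + 1) x := by
  have hh : InnerProductSpace.HarmonicOnNhd
      (fun z : ℂ => (halfPlanePoisson z.im z.re : ℂ)) {z : ℂ | 0 < z.im} := by
    have := (harmonicOnNhd_halfPlanePoisson 0).comp_CLM Complex.ofRealCLM
    simp only [sub_zero] at this
    exact this
  have := eq_integral_halfPlanePoisson_of_bounded (B := 1 / Real.pi) hh one_pos (fun z hz => by
    have hpi := Real.pi_pos
    have hz0 : 0 < z.im := one_pos.trans_le hz
    rw [Complex.norm_real, Real.norm_of_nonneg (halfPlanePoisson_pos hz0 _).le]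
    refine (halfPlanePoisson_le hz0 _).trans ?_
    gcongr
    exact le_mul_of_one_le_right hpi.le hz) hy (x := x)
  simp only [horizontalSlice, Complex.add_im, Complex.mul_I_im, Complex.ofReal_re,
    Complex.ofReal_im, zero_add, Complex.add_re, Complex.mul_I_re, neg_zero, add_zero] at this
  apply Complex.ofReal_injective
  rw [this, ← integral_complex_ofReal]
  simp

/-! ### Elementary properties of N-functions -/

lemma IsNFunction.nonneg {Φ : ℝ → ℝ} (hΦ : IsNFunction Φ) {t : ℝ} (ht : 0 ≤ t) : 0 ≤ Φ t := by
  have : Φ t ∈ Φ '' Set.Ici 0 := ⟨t, ht, rfl⟩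
  rwa [hΦ.image_eq] at this

lemma IsNFunction.mono {Φ : ℝ → ℝ} (hΦ : IsNFunction Φ) {s t : ℝ} (hs : 0 ≤ s) (hst : s ≤ t) :
    Φ s ≤ Φ t :=
  hΦ.monotoneOn hs (hs.trans hst : 0 ≤ t) hst

/-- Quantitative superlinearity; this is the source of all uniform integrability. -/
lemma IsNFunction.exists_le_add {Φ : ℝ → ℝ} (hΦ : IsNFunction Φ) {K : ℝ} (hK : 0 < K) :
    ∃ T, 0 < T ∧ ∀ s, 0 ≤ s → s ≤ T + K * Φ s := by
  obtain ⟨T, hT⟩ := eventually_atTop.1 (hΦ.tendsto_atTop.eventually_ge_atTop (1 / K))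
  refine ⟨max T 1, by positivity, fun s hs => ?_⟩
  have hΦs := mul_nonneg hK.le (hΦ.nonneg hs)
  rcases le_total s (max T 1) with h | h
  · linarith
  · have hs0 : 0 < s := lt_of_lt_of_le (by positivity) h
    have h1 := hT s ((le_max_left _ _).trans h)
    rw [div_le_div_iff₀ hK hs0, one_mul] at h1
    have : 0 < max T 1 := by positivity
    linarith

lemma IsNFunction.continuous_comp_norm_div {Φ : ℝ → ℝ} (hΦ : IsNFunction Φ) {r : ℝ} (hr : 0 < r) :
    Continuous fun z : ℂ => Φ (‖z‖ / r) :=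
  hΦ.continuousOn.comp_continuous (by fun_prop) fun z => div_nonneg (norm_nonneg z) hr.le

lemma IsNFunction.convexOn_comp_norm_div {Φ : ℝ → ℝ} (hΦ : IsNFunction Φ) {r : ℝ} (hr : 0 < r) :
    ConvexOn ℝ Set.univ fun z : ℂ => Φ (‖z‖ / r) := by
  refine ⟨convex_univ, fun z _ w _ a b ha hb hab => ?_⟩
  have h0 : ∀ z : ℂ, 0 ≤ ‖z‖ / r := fun z => div_nonneg (norm_nonneg z) hr.le
  refine (hΦ.mono (h0 _) ?_).trans (hΦ.convexOn.2 (h0 z) (h0 w) ha hb hab)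
  calc ‖a • z + b • w‖ / r ≤ (‖a • z‖ + ‖b • w‖) / r := by gcongr; exact norm_add_le _ _
    _ = a • (‖z‖ / r) + b • (‖w‖ / r) := by
      rw [norm_smul, norm_smul, Real.norm_of_nonneg ha, Real.norm_of_nonneg hb, add_div,
        mul_div_assoc, mul_div_assoc]
      rfl

lemma IsNFunction.measurable_ofReal_comp {Φ : ℝ → ℝ} (hΦ : IsNFunction Φ) {r : ℝ} (hr : 0 < r) :
    Measurable fun z : ℂ => ENNReal.ofReal (Φ (‖z‖ / r)) :=
  (hΦ.continuous_comp_norm_div hr).measurable.ennreal_ofReal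

/-- Young-type bound, integrated: for every `K` the `L¹`-norm is controlled by the total mass and
`K` times the modular. -/
lemma IsNFunction.exists_lintegral_enorm_le {Φ : ℝ → ℝ} (hΦ : IsNFunction Φ) {r K : ℝ} (hr : 0 < r)
    (hK : 0 < K) :
    ∃ T : ℝ, 0 < T ∧ ∀ {α : Type} [MeasurableSpace α] (μ : Measure α) (g : α → ℂ),
      ∫⁻ a, ‖g a‖ₑ ∂μ ≤ ENNReal.ofReal T * μ Set.univ +
        ENNReal.ofReal K * ∫⁻ a, ENNReal.ofReal (Φ (‖g a‖ / r)) ∂μ := by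
  obtain ⟨T, hT0, hT⟩ := hΦ.exists_le_add (K := K / r) (by positivity)
  refine ⟨r * T, by positivity, fun μ g => ?_⟩
  rw [← lintegral_const, ← lintegral_const_mul' _ _ ENNReal.ofReal_ne_top,
    ← lintegral_add_left measurable_const]
  refine lintegral_mono fun a => ?_
  have h0 : 0 ≤ ‖g a‖ / r := by positivity
  rw [← ENNReal.ofReal_mul hK.le, ← ENNReal.ofReal_add (by positivity)
    (mul_nonneg hK.le (hΦ.nonneg h0)), ← ofReal_norm]
  apply ENNReal.ofReal_le_ofReal
  have := hT _ h0
  rw [div_le_iff₀ hr] at this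
  calc ‖g a‖ ≤ _ := this
    _ = _ := by field_simp

/-! ### Boundedness away from the real line -/

/-- The mean value inequality over discs, with a non-optimal constant. -/
lemma mul_enorm_le_lintegral_ball {F : ℂ → ℂ}
    (hF : InnerProductSpace.HarmonicOnNhd F {z : ℂ | 0 < z.im}) {z : ℂ} {ρ : ℝ} (hρ0 : 0 < ρ)
    (hρ : ρ < z.im) :
    ENNReal.ofReal ((ρ / 2) ^ 2 * (2 * Real.pi)) * ‖F z‖ₑ ≤ ∫⁻ w in Metric.ball z ρ, ‖F w‖ₑ := by
  have hpi := Real.pi_pos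
  have hFc : ContinuousOn F {z : ℂ | 0 < z.im} := hF.contDiffOn.continuousOn
  have hUo : IsOpen {z : ℂ | 0 < z.im} := isOpen_lt continuous_const Complex.continuous_im
  -- The inequality over circles.
  have hcircle : ∀ s, 0 < s → s < ρ → ENNReal.ofReal (2 * Real.pi) * ‖F z‖ₑ ≤
      ∫⁻ θ in Set.Ioo (-Real.pi) Real.pi, ‖F (circleMap z s θ)‖ₑ := fun s hs hsρ => by
    have h1 := circleAverage_eq_of_harmonicOnNhd hF hs (hsρ.trans hρ)
    rw [Real.circleAverage_eq_integral_add (-Real.pi),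
      intervalIntegral.integral_comp_add_right (fun θ => F (circleMap z s θ)), zero_add,
      inv_smul_eq_iff₀ (by positivity), show 2 * Real.pi + -Real.pi = Real.pi by ring,
      intervalIntegral.integral_of_le (by linarith), integral_Ioc_eq_integral_Ioo] at h1
    rw [← Real.enorm_of_nonneg (by positivity : 0 ≤ 2 * Real.pi), ← enorm_smul, ← h1]
    exact enorm_integral_le_lintegral_enorm _
  set G : ℂ → ℝ≥0∞ := (Metric.ball z ρ).indicator fun w => ‖F w‖ₑ with hG
  have hGm : Measurable G := by
    -- `F` itself need not be measurable off the half-plane.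
    have h1 : Measurable ({z : ℂ | 0 < z.im}.piecewise F 0) :=
      hFc.measurable_piecewise continuousOn_const hUo.measurableSet
    have h2 : G = (Metric.ball z ρ).indicator fun w => ‖({z : ℂ | 0 < z.im}.piecewise F 0) w‖ₑ := by
      refine Set.indicator_congr fun w hw => ?_
      rw [Set.piecewise_eq_of_mem _ _ _ (closedBall_subset_halfPlane hρ
        (Metric.ball_subset_closedBall hw))]
    rw [h2]
    exact h1.enorm.indicator measurableSet_ball
  have hpol : ∀ s θ : ℝ, z + Complex.polarCoord.symm (s, θ) = circleMap z s θ := fun s θ => by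
    rw [Complex.polarCoord_symm_apply, circleMap, Complex.exp_mul_I]
    simp
  rw [← lintegral_indicator measurableSet_ball, ← lintegral_add_left_eq_self _ z,
    ← Complex.lintegral_comp_polarCoord_symm]
  have htarget : polarCoord.target = Set.Ioi (0 : ℝ) ×ˢ Set.Ioo (-Real.pi) Real.pi := rfl
  have hmeas : Measurable fun p : ℝ × ℝ =>
      ENNReal.ofReal p.1 • G (z + Complex.polarCoord.symm p) := by
    simp_rw [Complex.polarCoord_symm_apply]
    have h1 : Measurable fun p : ℝ × ℝ =>
        z + p.1 * (Real.cos p.2 + Real.sin p.2 * Complex.I : ℂ) := by fun_prop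
    exact measurable_fst.ennreal_ofReal.smul (hGm.comp h1)
  rw [htarget, Measure.volume_eq_prod, ← Measure.prod_restrict,
    lintegral_prod _ hmeas.aemeasurable]
  calc ENNReal.ofReal ((ρ / 2) ^ 2 * (2 * Real.pi)) * ‖F z‖ₑ
      = ∫⁻ _ in Set.Ioo (ρ / 2) ρ, ENNReal.ofReal (ρ / 2) *
          (ENNReal.ofReal (2 * Real.pi) * ‖F z‖ₑ) := by
        rw [lintegral_const, Measure.restrict_apply_univ, Real.volume_Ioo, sub_half,
          ENNReal.ofReal_mul (by positivity), sq, ENNReal.ofReal_mul (by positivity)]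
        ring
    _ ≤ ∫⁻ s in Set.Ioo (ρ / 2) ρ, ∫⁻ θ in Set.Ioo (-Real.pi) Real.pi,
          ENNReal.ofReal s • G (z + Complex.polarCoord.symm (s, θ)) := by
        refine setLIntegral_mono' measurableSet_Ioo fun s hs => ?_
        have hs0 : 0 < s := (half_pos hρ0).trans hs.1
        simp only [smul_eq_mul]
        rw [lintegral_const_mul' _ _ ENNReal.ofReal_ne_top]
        refine mul_le_mul' (ENNReal.ofReal_le_ofReal hs.1.le) ((hcircle s hs0 hs.2).trans_eq ?_)
        refine lintegral_congr fun θ => ?_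
        rw [hpol, hG, Set.indicator_of_mem]
        rw [mem_ball_iff_norm, circleMap_sub_center, norm_circleMap_zero, abs_of_pos hs0]
        exact hs.2
    _ ≤ _ := lintegral_mono_set fun s hs => (half_pos hρ0).trans hs.1

/-- Tonelli's theorem on a horizontal strip. -/
lemma lintegral_strip_le {a b : ℝ} {G : ℂ → ℝ≥0∞} {C : ℝ≥0∞}
    (hGm : Measurable G)
    (hG : ∀ y ∈ Set.Ioo a b, ∫⁻ x : ℝ, G (x + y * Complex.I) ≤ C) :
    ∫⁻ w in {w : ℂ | w.im ∈ Set.Ioo a b}, G w ≤ C * ENNReal.ofReal (b - a) := by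
  have hset : MeasurableSet {w : ℂ | w.im ∈ Set.Ioo a b} :=
    Complex.measurable_im measurableSet_Ioo
  rw [← lintegral_indicator hset, ← (Complex.volume_preserving_equiv_real_prod.symm).lintegral_comp
    (hGm.indicator hset), Measure.volume_eq_prod, lintegral_prod_symm']
  · rw [← Real.volume_Ioo, ← setLIntegral_const, ← lintegral_indicator measurableSet_Ioo]
    refine lintegral_mono fun y => ?_
    by_cases hy : y ∈ Set.Ioo a b
    · rw [Set.indicator_of_mem hy]
      refine (lintegral_mono fun x => ?_).trans (hG y hy)
      refine (Set.indicator_le_self _ _ _).trans_eq ?_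
      congr 1
      apply Complex.ext <;> simp [Complex.measurableEquivRealProd]
    · rw [Set.indicator_of_notMem hy, nonpos_iff_eq_zero]
      refine (lintegral_congr fun x => ?_).trans lintegral_zero
      exact Set.indicator_of_notMem (by simpa [Complex.measurableEquivRealProd] using hy) _
  · exact (hGm.indicator hset).comp (by fun_prop)

/-- A bound on the modulars of all horizontal slices makes `F` bounded away from the real line: a
disc meets only the slices in a strip of finite height, so the mean of `‖F‖` over it is
controlled. -/
theorem exists_bound_of_lintegral_le {Φ : ℝ → ℝ} (hΦ : IsNFunction Φ) {F : ℂ → ℂ} {r : ℝ}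
    (hF : InnerProductSpace.HarmonicOnNhd F {z : ℂ | 0 < z.im}) (hr : 0 < r)
    (hmod : ∀ y, 0 < y → ∫⁻ x, ENNReal.ofReal (Φ (‖horizontalSlice F y x‖ / r)) ≤ 1)
    {δ : ℝ} (hδ : 0 < δ) : ∃ B : ℝ, ∀ z : ℂ, δ ≤ z.im → ‖F z‖ ≤ B := by
  have hpi := Real.pi_pos
  obtain ⟨T, hT0, hT⟩ := hΦ.exists_lintegral_enorm_le hr one_pos
  set ρ := δ / 2 with hρ
  have hρ0 : 0 < ρ := half_pos hδ
  have hFc : ContinuousOn F {z : ℂ | 0 < z.im} := hF.contDiffOn.continuousOn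
  have hUo : IsOpen {z : ℂ | 0 < z.im} := isOpen_lt continuous_const Complex.continuous_im
  -- The values of `F` off the half-plane are arbitrary; `Ft` is a measurable modification.
  set Ft : ℂ → ℂ := {z : ℂ | 0 < z.im}.piecewise F 0 with hFt
  have hFtm : Measurable Ft := hFc.measurable_piecewise continuousOn_const hUo.measurableSet
  have hFtF : ∀ w : ℂ, 0 < w.im → Ft w = F w := fun w hw => Set.piecewise_eq_of_mem _ _ _ hw
  set D : ℝ≥0∞ := ENNReal.ofReal T * (ENNReal.ofReal ρ ^ 2 * NNReal.pi) +
    ENNReal.ofReal 1 * (1 * ENNReal.ofReal (2 * ρ)) with hD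
  have hDtop : D ≠ ∞ := by
    simp [hD, ENNReal.mul_eq_top]
  set c := (ρ / 2) ^ 2 * (2 * Real.pi) with hc
  have hc0 : 0 < c := by positivity
  -- `c` is the constant of the mean value inequality and `D` bounds the integral of `‖F‖` over the
  -- disc; neither depends on `z`.
  refine ⟨D.toReal / c, fun z hz => ?_⟩
  have hρz : ρ < z.im := by linarith
  have key : ENNReal.ofReal c * ‖F z‖ₑ ≤ D := by
    refine (mul_enorm_le_lintegral_ball hF hρ0 hρz).trans ((hT _ _).trans ?_)
    rw [Measure.restrict_apply_univ, Complex.volume_ball]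
    refine add_le_add le_rfl (mul_le_mul' le_rfl ?_)
    calc ∫⁻ w in Metric.ball z ρ, ENNReal.ofReal (Φ (‖F w‖ / r))
        = ∫⁻ w in Metric.ball z ρ, ENNReal.ofReal (Φ (‖Ft w‖ / r)) := by
          refine setLIntegral_congr_fun measurableSet_ball fun w hw => ?_
          rw [hFtF w (closedBall_subset_halfPlane hρz (Metric.ball_subset_closedBall hw))]
      _ ≤ ∫⁻ w in {w : ℂ | w.im ∈ Set.Ioo (z.im - ρ) (z.im + ρ)},
            ENNReal.ofReal (Φ (‖Ft w‖ / r)) := by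
          refine lintegral_mono_set fun w hw => ?_
          have h1 := (Complex.abs_im_le_norm (w - z)).trans_lt (mem_ball_iff_norm.1 hw)
          rw [Complex.sub_im, abs_lt] at h1
          exact ⟨by linarith, by linarith⟩
      _ ≤ 1 * ENNReal.ofReal (z.im + ρ - (z.im - ρ)) := by
          refine lintegral_strip_le ((hΦ.measurable_ofReal_comp hr).comp hFtm) fun y hy => ?_
          have hy0 : 0 < y := (sub_pos.2 hρz).trans hy.1
          refine le_trans (le_of_eq (lintegral_congr fun x => ?_)) (hmod y hy0)
          rw [hFtF _ (by simpa using hy0), horizontalSlice]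
      _ = _ := by congr 2; ring
  rw [le_div_iff₀' hc0, ← ENNReal.ofReal_le_ofReal_iff ENNReal.toReal_nonneg,
    ENNReal.ofReal_toReal hDtop, ENNReal.ofReal_mul hc0.le, ofReal_norm]
  exact key

/-! ### Weak compactness of uniformly integrable sequences -/

section WeakLimit

variable {α : Type*} [MeasurableSpace α] {μ : Measure α} [IsFiniteMeasure μ]

/-- A bounded measurable function is a uniform limit of simple functions. -/
lemma exists_simpleFunc_abs_sub_le {h : α → ℝ} {M : ℝ} (hm : Measurable h) (hM : ∀ a, |h a| ≤ M)
    {ε : ℝ} (hε : 0 < ε) : ∃ s : SimpleFunc α ℝ, ∀ a, |h a - s a| ≤ ε := by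
  have hfin : (Set.range fun a => ε * (⌊h a / ε⌋ : ℝ)).Finite := by
    refine ((Set.finite_Icc ⌊-M / ε⌋ ⌊M / ε⌋).image fun j : ℤ => ε * (j : ℝ)).subset ?_
    rintro _ ⟨a, rfl⟩
    have := abs_le.1 (hM a)
    exact ⟨⌊h a / ε⌋, ⟨Int.floor_le_floor (by gcongr; exact this.1),
      Int.floor_le_floor (by gcongr; exact this.2)⟩, rfl⟩
  have hmeas : Measurable fun a => ε * (⌊h a / ε⌋ : ℝ) :=
    ((measurable_from_top (f := fun j : ℤ => (j : ℝ))).comp (hm.div_const ε).floor).const_mul ε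
  refine ⟨⟨_, fun x => hmeas (measurableSet_singleton x), hfin⟩, fun a => ?_⟩
  change |h a - ε * (⌊h a / ε⌋ : ℝ)| ≤ ε
  have h1 := Int.floor_le (h a / ε)
  have h2 := Int.lt_floor_add_one (h a / ε)
  rw [le_div_iff₀' hε] at h1
  rw [div_lt_iff₀' hε] at h2
  rw [abs_le]
  constructor <;> linarith

/-- A limit of measures given by a uniformly integrable sequence of densities, along an ultrafilter,
is countably additive. -/
lemma exists_signedMeasure_tendsto {g : ℕ → α → ℝ} {C : ℝ} (U : Ultrafilter ℕ)
    (hint : ∀ n, Integrable (g n) μ) (hC : ∀ n, ∫ a, |g n a| ∂μ ≤ C)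
    (hui : ∀ ε > 0, ∃ η > 0, ∀ n s, MeasurableSet s → μ.real s < η → |∫ a in s, g n a ∂μ| ≤ ε) :
    ∃ ν : SignedMeasure α, ∀ s, MeasurableSet s →
      Tendsto (fun n => ∫ a in s, g n a ∂μ) U (𝓝 (ν s)) := by
  have hlim : ∀ s, ∃ l, Tendsto (fun n => ∫ a in s, g n a ∂μ) U (𝓝 l) := fun s => by
    have hmem : Set.Icc (-C) C ∈ U.map fun n => ∫ a in s, g n a ∂μ := by
      rw [Ultrafilter.mem_map]
      refine Filter.univ_mem' fun n => abs_le.1 ?_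
      refine (abs_integral_le_integral_abs).trans (le_trans ?_ (hC n))
      exact setIntegral_le_integral (hint n).abs (ae_of_all _ fun a => abs_nonneg _)
    obtain ⟨l, -, hl⟩ := isCompact_Icc.ultrafilter_le_nhds' _ hmem
    exact ⟨l, hl⟩
  choose l hl using hlim
  classical
  refine ⟨⟨fun s => if MeasurableSet s then l s else 0, ?_, fun s hs => if_neg hs,
    fun A hA hd => ?_⟩, fun s hs => ?_⟩
  · rw [if_pos MeasurableSet.empty]
    exact tendsto_nhds_unique (hl ∅) (by simp)
  · simp only [hA, MeasurableSet.iUnion hA, if_true]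
    rw [HasSum, SummationFilter.unconditional_filter, Metric.tendsto_atTop]
    intro ε hε
    obtain ⟨η, hη, hηs⟩ := hui (ε / 2) (half_pos hε)
    have hsum : HasSum (fun i => μ.real (A i)) (μ.real (⋃ i, A i)) := by
      have := VectorMeasure.hasSum_of_disjoint_iUnion (v := μ.toSignedMeasure) hA hd
      simpa only [Measure.toSignedMeasure_apply_measurable, hA, MeasurableSet.iUnion hA] using this
    rw [HasSum, SummationFilter.unconditional_filter, Metric.tendsto_atTop] at hsum
    obtain ⟨N, hN⟩ := hsum η hη
    refine ⟨N, fun s hs => ?_⟩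
    have hBm : MeasurableSet (⋃ i ∈ s, A i) := s.measurableSet_biUnion fun i _ => hA i
    have hBsub : (⋃ i ∈ s, A i) ⊆ ⋃ i, A i := Set.iUnion₂_subset fun i _ => Set.subset_iUnion A i
    have hdiff : μ.real ((⋃ i, A i) \ ⋃ i ∈ s, A i) < η := by
      rw [measureReal_sdiff hBsub hBm, measureReal_biUnion_finset (fun i _ j _ h => hd h)
        fun i _ => hA i]
      have := hN s hs
      rw [Real.dist_eq, abs_lt] at this
      linarith
    refine lt_of_le_of_lt ?_ (half_lt_self hε)
    refine le_of_tendsto ((tendsto_finsetSum s fun i _ => hl (A i)).dist (hl (⋃ i, A i)))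
      (Eventually.of_forall fun n => ?_)
    have e1 : ∑ i ∈ s, ∫ a in A i, g n a ∂μ = ∫ a in ⋃ i ∈ s, A i, g n a ∂μ :=
      (integral_biUnion_finset s (fun i _ => hA i) (fun i _ j _ h => hd h)
        fun i _ => (hint n).integrableOn).symm
    rw [e1, dist_comm, Real.dist_eq, ← setIntegral_sdiff hBm (hint n).integrableOn hBsub]
    exact hηs n _ ((MeasurableSet.iUnion hA).diff hBm) hdiff
  · change Tendsto _ _ (𝓝 (if MeasurableSet s then l s else 0))
    rw [if_pos hs]
    exact hl s

/-- Weak convergence for real densities: the limit density is the Radon–Nikodym derivative of the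
limit measure, and bounded test functions are uniform limits of simple ones. -/
lemma exists_tendsto_integral_mul_real {g : ℕ → α → ℝ} {C : ℝ} (U : Ultrafilter ℕ)
    (hint : ∀ n, Integrable (g n) μ) (hC : ∀ n, ∫ a, |g n a| ∂μ ≤ C)
    (hui : ∀ ε > 0, ∃ η > 0, ∀ n s, MeasurableSet s → μ.real s < η → |∫ a in s, g n a ∂μ| ≤ ε) :
    ∃ f : α → ℝ, Integrable f μ ∧ ∀ (h : α → ℝ) (M : ℝ), Measurable h → (∀ a, |h a| ≤ M) →
      Tendsto (fun n => ∫ a, h a * g n a ∂μ) U (𝓝 (∫ a, h a * f a ∂μ)) := by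
  obtain ⟨ν, hν⟩ := exists_signedMeasure_tendsto U hint hC hui
  have hac : ν ≪ᵥ μ.toENNRealVectorMeasure := by
    refine VectorMeasure.AbsolutelyContinuous.mk fun s hs h0 => ?_
    rw [Measure.toENNRealVectorMeasure_apply_measurable hs] at h0
    refine tendsto_nhds_unique (hν s hs) ?_
    simp [Measure.restrict_eq_zero.2 h0]
  set f := ν.rnDeriv μ with hf
  have hfint : Integrable f μ := SignedMeasure.integrable_rnDeriv ν μ
  have hνf : ∀ s, MeasurableSet s → ν s = ∫ a in s, f a ∂μ := fun s hs => by
    rw [← withDensityᵥ_apply hfint hs, hf, SignedMeasure.withDensityᵥ_rnDeriv_eq ν μ hac]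
  have hsmul : ∀ {q : α → ℝ}, Integrable q μ → ∀ s : SimpleFunc α ℝ,
      Integrable (fun a => s a * q a) μ := fun hq s => by
    obtain ⟨c, hc⟩ := s.exists_forall_norm_le
    exact hq.bdd_mul s.aestronglyMeasurable (ae_of_all _ hc)
  have hsimple : ∀ s : SimpleFunc α ℝ,
      Tendsto (fun n => ∫ a, s a * g n a ∂μ) U (𝓝 (∫ a, s a * f a ∂μ)) := by
    intro s
    induction s using SimpleFunc.induction with
    | const c hs =>
      rename_i s
      have key : ∀ q : α → ℝ, ∫ a, (SimpleFunc.piecewise s hs (SimpleFunc.const α c)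
          (SimpleFunc.const α 0)) a * q a ∂μ = c * ∫ a in s, q a ∂μ := fun q => by
        rw [← integral_const_mul, ← integral_indicator hs]
        congr 1 with a
        by_cases ha : a ∈ s <;> simp [ha]
      simp_rw [key, ← hνf s hs]
      exact (hν s hs).const_mul c
    | add _ hp hq =>
      simp only [SimpleFunc.coe_add, Pi.add_apply, add_mul]
      rw [integral_add (hsmul hfint _) (hsmul hfint _)]
      refine (hp.add hq).congr fun n => ?_
      rw [integral_add (hsmul (hint n) _) (hsmul (hint n) _)]
  refine ⟨f, hfint, fun h M hm hM => ?_⟩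
  have hmul : ∀ {q : α → ℝ}, Integrable q μ → Integrable (fun a => h a * q a) μ := fun hq =>
    hq.bdd_mul hm.aestronglyMeasurable (ae_of_all _ hM)
  have happrox : ∀ {q : α → ℝ} (s : SimpleFunc α ℝ) (ε : ℝ), Integrable q μ →
      (∀ a, |h a - s a| ≤ ε) →
      dist (∫ a, h a * q a ∂μ) (∫ a, s a * q a ∂μ) ≤ ε * ∫ a, |q a| ∂μ := fun s ε hq hs => by
    rw [Real.dist_eq, ← integral_sub (hmul hq) (hsmul hq s), ← integral_const_mul]
    refine abs_integral_le_integral_abs.trans (integral_mono_of_nonneg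
      (ae_of_all _ fun _ => abs_nonneg _) (hq.abs.const_mul ε) (ae_of_all _ fun a => ?_))
    simp only [← sub_mul, abs_mul]
    exact mul_le_mul_of_nonneg_right (hs a) (abs_nonneg _)
  have hC0 : 0 ≤ C := (integral_nonneg fun a => abs_nonneg (g 0 a)).trans (hC 0)
  set D := C + (∫ a, |f a| ∂μ) + 1 with hD
  have hf0 : 0 ≤ ∫ a, |f a| ∂μ := integral_nonneg fun a => abs_nonneg _
  rw [Metric.tendsto_nhds]
  intro ε hε
  obtain ⟨s, hs⟩ := exists_simpleFunc_abs_sub_le hm hM (ε := ε / (2 * D)) (by positivity)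
  filter_upwards [Metric.tendsto_nhds.1 (hsimple s) (ε / 2) (half_pos hε)] with n hn
  have h1 := happrox s _ (hint n) hs
  have h2 := happrox s _ hfint hs
  have h3 := mul_le_mul_of_nonneg_left (hC n) (by positivity : 0 ≤ ε / (2 * D))
  have h4 : ε / (2 * D) * C + ε / (2 * D) * ∫ a, |f a| ∂μ < ε / 2 := by
    have : ε / (2 * D) * D = ε / 2 := by
      have hD0 : D ≠ 0 := by positivity
      field_simp
    have hpos : 0 < ε / (2 * D) := by positivity
    rw [hD, mul_add, mul_add, mul_one, ← hD] at this
    linarith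
  have h5 := dist_triangle4 (∫ a, h a * g n a ∂μ) (∫ a, s a * g n a ∂μ) (∫ a, s a * f a ∂μ)
    (∫ a, h a * f a ∂μ)
  rw [dist_comm (∫ a, s a * f a ∂μ)] at h5
  linarith

/-- Sequential form of the Dunford–Pettis theorem: a bounded, uniformly integrable sequence on a
finite measure space converges weakly in `L¹` along every ultrafilter. -/
theorem exists_tendsto_integral_smul {g : ℕ → α → ℂ} {C : ℝ} (U : Ultrafilter ℕ)
    (hint : ∀ n, Integrable (g n) μ) (hC : ∀ n, ∫ a, ‖g n a‖ ∂μ ≤ C)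
    (hui : ∀ ε > 0, ∃ η > 0, ∀ n s, MeasurableSet s → μ.real s < η → ‖∫ a in s, g n a ∂μ‖ ≤ ε) :
    ∃ f : α → ℂ, Integrable f μ ∧ ∀ (h : α → ℝ) (M : ℝ), Measurable h → (∀ a, |h a| ≤ M) →
      Tendsto (fun n => ∫ a, h a • g n a ∂μ) U (𝓝 (∫ a, h a • f a ∂μ)) := by
  have key : ∀ L : ℂ →L[ℝ] ℝ, (∀ z, |L z| ≤ ‖z‖) → ∃ f : α → ℝ, Integrable f μ ∧
      ∀ (h : α → ℝ) (M : ℝ), Measurable h → (∀ a, |h a| ≤ M) →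
      Tendsto (fun n => ∫ a, h a * L (g n a) ∂μ) U (𝓝 (∫ a, h a * f a ∂μ)) := fun L hL => by
    refine exists_tendsto_integral_mul_real (C := C) U (fun n => L.integrable_comp (hint n))
      (fun n => ?_) fun ε hε => ?_
    · exact (integral_mono (L.integrable_comp (hint n)).abs (hint n).norm
        fun a => hL _).trans (hC n)
    · obtain ⟨η, hη, h⟩ := hui ε hε
      refine ⟨η, hη, fun n s hs hsη => ?_⟩
      rw [L.integral_comp_comm (hint n).integrableOn]
      exact (hL _).trans (h n s hs hsη)
  obtain ⟨u, hu, hut⟩ := key Complex.reCLM Complex.abs_re_le_norm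
  obtain ⟨v, hv, hvt⟩ := key Complex.imCLM Complex.abs_im_le_norm
  have hf : Integrable (fun a => (u a : ℂ) + v a * Complex.I) μ :=
    hu.ofReal.add (hv.ofReal.mul_const _)
  refine ⟨_, hf, fun h M hm hM => ?_⟩
  have hsplit : ∀ {q : α → ℂ}, Integrable q μ → ∫ a, h a • q a ∂μ =
      ((∫ a, h a * (q a).re ∂μ : ℝ) : ℂ) + ((∫ a, h a * (q a).im ∂μ : ℝ) : ℂ) * Complex.I :=
    fun {q} hq => by
    have hhq : Integrable (fun a => h a • q a) μ :=
      hq.bdd_smul M hm.aestronglyMeasurable (ae_of_all _ hM)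
    have h1 := Complex.reCLM.integral_comp_comm hhq
    have h2 := Complex.imCLM.integral_comp_comm hhq
    simp only [Complex.reCLM_apply, Complex.imCLM_apply, Complex.smul_re, Complex.smul_im,
      smul_eq_mul] at h1 h2
    rw [h1, h2, Complex.re_add_im]
  rw [hsplit hf]
  simp_rw [fun n => hsplit (hint n)]
  have h1 := (Complex.continuous_ofReal.tendsto _).comp (hut h M hm hM)
  have h2 := (Complex.continuous_ofReal.tendsto _).comp (hvt h M hm hM)
  simpa using h1.add (h2.mul_const Complex.I)

end WeakLimit

/-! ### Harmonic measure and Poisson extensions -/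

/-- Harmonic measure of the upper half-plane with pole `x + iy`. The measures with different poles
are mutually comparable; the one with pole `i` serves as the finite reference measure on `ℝ`. -/
def harmonicMeasure (x y : ℝ) : Measure ℝ :=
  volume.withDensity fun t => ENNReal.ofReal (halfPlanePoisson y (x - t))

lemma isProbabilityMeasure_harmonicMeasure {y : ℝ} (hy : 0 < y) (x : ℝ) :
    IsProbabilityMeasure (harmonicMeasure x y) :=
  ⟨by rw [harmonicMeasure, withDensity_apply _ MeasurableSet.univ, Measure.restrict_univ,
    lintegral_halfPlanePoisson hy]⟩

instance : IsProbabilityMeasure (harmonicMeasure 0 1) :=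
  isProbabilityMeasure_harmonicMeasure one_pos 0

lemma lintegral_harmonicMeasure (x y : ℝ) (g : ℝ → ℝ≥0∞) :
    ∫⁻ t, g t ∂harmonicMeasure x y =
      ∫⁻ t, ENNReal.ofReal (halfPlanePoisson y (x - t)) * g t := by
  rw [harmonicMeasure, lintegral_withDensity_eq_lintegral_mul_non_measurable]
  · rfl
  · fun_prop
  · exact ae_of_all _ fun _ => ENNReal.ofReal_lt_top

lemma integrable_harmonicMeasure_iff {y : ℝ} (hy : 0 < y) {x : ℝ} {g : ℝ → ℂ} :
    Integrable g (harmonicMeasure x y) ↔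
      Integrable fun t => (halfPlanePoisson y (x - t) : ℂ) * g t := by
  rw [harmonicMeasure, integrable_withDensity_iff_integrable_smul' (by fun_prop)
    (ae_of_all _ fun _ => ENNReal.ofReal_lt_top)]
  simp only [ENNReal.toReal_ofReal (halfPlanePoisson_pos hy _).le, Complex.real_smul]

lemma integral_harmonicMeasure {y : ℝ} (hy : 0 < y) (x : ℝ) (g : ℝ → ℂ) :
    ∫ t, g t ∂harmonicMeasure x y = ∫ t, (halfPlanePoisson y (x - t) : ℂ) * g t := by
  rw [harmonicMeasure, integral_withDensity_eq_integral_toReal_smul (by fun_prop)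
    (ae_of_all _ fun _ => ENNReal.ofReal_lt_top)]
  simp only [ENNReal.toReal_ofReal (halfPlanePoisson_pos hy _).le, Complex.real_smul]

lemma harmonicMeasure_absolutelyContinuous (x y : ℝ) : harmonicMeasure x y ≪ volume :=
  withDensity_absolutelyContinuous _ _

lemma volume_absolutelyContinuous_harmonicMeasure {y : ℝ} (hy : 0 < y) (x : ℝ) :
    volume ≪ harmonicMeasure x y :=
  withDensity_absolutelyContinuous' (by fun_prop)
    (ae_of_all _ fun t => (ENNReal.ofReal_pos.2 (halfPlanePoisson_pos hy _)).ne')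

lemma harmonicMeasure_le_volume : harmonicMeasure 0 1 ≤ volume := by
  refine (withDensity_mono (ae_of_all _ fun t => ?_)).trans_eq withDensity_one
  refine ENNReal.ofReal_le_one.2 ((halfPlanePoisson_le one_pos _).trans ?_)
  rw [mul_one, div_le_one Real.pi_pos]
  linarith [Real.pi_gt_three]

/-- Integrability against one harmonic measure implies integrability against all of them. -/
lemma integrable_harmonicMeasure {f : ℝ → ℂ} (hf : Integrable f (harmonicMeasure 0 1)) {y : ℝ}
    (hy : 0 < y) (x : ℝ) : Integrable f (harmonicMeasure x y) := by
  have hfm : AEStronglyMeasurable f volume :=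
    hf.1.mono_ac (volume_absolutelyContinuous_harmonicMeasure one_pos 0)
  rw [integrable_harmonicMeasure_iff one_pos] at hf
  rw [integrable_harmonicMeasure_iff hy]
  have hR : |x| ≤ |x| + y := by linarith
  have hyR : y ≤ |x| + y := by linarith [abs_nonneg x]
  refine (hf.norm.const_mul ((|x| + y) * (2 + (2 * (|x| + y) ^ 2 + 1) / y ^ 2))).mono' ?_
    (ae_of_all _ fun t => ?_)
  · exact (Measurable.aestronglyMeasurable (by fun_prop)).mul hfm
  · have h := halfPlanePoisson_le_mul_one hy hR le_rfl hyR t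
    rw [zero_sub, halfPlanePoisson_neg, norm_mul, norm_mul, Complex.norm_real, Complex.norm_real,
      Real.norm_of_nonneg (halfPlanePoisson_pos hy _).le,
      Real.norm_of_nonneg (halfPlanePoisson_pos one_pos _).le, ← mul_assoc]
    exact mul_le_mul_of_nonneg_right h (norm_nonneg _)

lemma IsPoissonIntegral.integrable {f : ℝ → ℂ} {F : ℂ → ℂ} (h : IsPoissonIntegral f F) {y : ℝ}
    (hy : 0 < y) (x : ℝ) : Integrable f (harmonicMeasure x y) :=
  (integrable_harmonicMeasure_iff hy).2 (h x y hy).1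

lemma IsPoissonIntegral.horizontalSlice_eq {f : ℝ → ℂ} {F : ℂ → ℂ} (h : IsPoissonIntegral f F)
    {y : ℝ} (hy : 0 < y) (x : ℝ) : horizontalSlice F y x = ∫ t, f t ∂harmonicMeasure x y := by
  rw [integral_harmonicMeasure hy, horizontalSlice, (h x y hy).2]

/-- Tonelli's theorem for Poisson averages. -/
lemma lintegral_lintegral_harmonicMeasure_swap {φ ψ : ℝ → ℝ≥0∞} (hφ : Measurable φ)
    (hψ : AEMeasurable ψ) (y : ℝ) :
    ∫⁻ x, φ x * ∫⁻ t, ψ t ∂harmonicMeasure x y =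
      ∫⁻ t, ψ t * ∫⁻ x, φ x * ENNReal.ofReal (halfPlanePoisson y (x - t)) := by
  have h1 : ∀ x, φ x * ∫⁻ t, ψ t ∂harmonicMeasure x y =
      ∫⁻ t, φ x * (ENNReal.ofReal (halfPlanePoisson y (x - t)) * ψ t) := fun x => by
    rw [lintegral_harmonicMeasure, lintegral_const_mul'' _ (by fun_prop)]
  simp_rw [h1]
  rw [lintegral_lintegral_swap]
  · refine lintegral_congr fun t => ?_
    rw [← lintegral_const_mul _ (by fun_prop)]
    refine lintegral_congr fun x => ?_
    ring
  · have h2 : AEMeasurable (fun p : ℝ × ℝ => ψ p.2) (volume.prod volume) :=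
      hψ.comp_quasiMeasurePreserving Measure.quasiMeasurePreserving_snd
    have h3 : Measurable fun p : ℝ × ℝ => φ p.1 := hφ.comp measurable_fst
    have h4 : Measurable fun p : ℝ × ℝ => ENNReal.ofReal (halfPlanePoisson y (p.1 - p.2)) := by
      fun_prop
    exact h3.aemeasurable.mul (h4.aemeasurable.mul h2)

/-! ### Convergence to the boundary values -/

/-- Poisson averaging is bounded on `L¹` of the reference measure, by the semigroup property of the
kernel. -/
lemma lintegral_lintegral_harmonicMeasure_le {ψ : ℝ → ℝ≥0∞} (hψ : AEMeasurable ψ) {y : ℝ}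
    (hy : 0 < y) :
    ∫⁻ x, ∫⁻ t, ψ t ∂harmonicMeasure x y ∂harmonicMeasure 0 1 ≤
      ENNReal.ofReal (1 + y) * ∫⁻ t, ψ t ∂harmonicMeasure 0 1 := by
  rw [lintegral_harmonicMeasure, lintegral_lintegral_harmonicMeasure_swap (by fun_prop) hψ,
    lintegral_harmonicMeasure, ← lintegral_const_mul'' _ (by fun_prop)]
  refine lintegral_mono fun t => ?_
  have hint : Integrable fun x => halfPlanePoisson y (t - x) * halfPlanePoisson 1 x :=
    (integrable_halfPlanePoisson_one.mul_bdd
      (Measurable.aestronglyMeasurable (f := fun x => halfPlanePoisson y (t - x)) (by fun_prop))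
      (c := 1 / (Real.pi * y)) (ae_of_all _ fun x => by
        rw [Real.norm_of_nonneg (halfPlanePoisson_pos hy _).le]
        exact halfPlanePoisson_le hy _)).congr (ae_of_all _ fun x => mul_comm _ _)
  have e : ∫⁻ x, ENNReal.ofReal (halfPlanePoisson 1 (0 - x)) *
      ENNReal.ofReal (halfPlanePoisson y (x - t)) =
      ENNReal.ofReal (halfPlanePoisson (y + 1) t) := by
    rw [← integral_halfPlanePoisson_mul hy, ofReal_integral_eq_lintegral_ofReal hint
      (ae_of_all _ fun x =>
        (mul_pos (halfPlanePoisson_pos hy _) (halfPlanePoisson_pos one_pos _)).le)]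
    refine lintegral_congr fun x => ?_
    rw [← ENNReal.ofReal_mul (halfPlanePoisson_pos one_pos _).le, zero_sub, halfPlanePoisson_neg,
      ← neg_sub t x, halfPlanePoisson_neg, mul_comm]
  simp only [e]
  rw [mul_comm, ← mul_assoc, ← ENNReal.ofReal_mul (by positivity), zero_sub, halfPlanePoisson_neg,
    add_comm y 1]
  gcongr
  exact halfPlanePoisson_one_add_le hy t

/-- For bounded continuous boundary values the Poisson integral converges in `L¹` of the reference
measure. -/
lemma tendsto_lintegral_enorm_sub_of_continuous {g : ℝ → ℂ} {B : ℝ} (hg : Continuous g)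
    (hB : ∀ t, ‖g t‖ ≤ B) :
    Tendsto (fun y => ∫⁻ x, ‖(∫ s, halfPlanePoisson 1 s • g (x - y * s)) - g x‖ₑ
      ∂harmonicMeasure 0 1)
      (𝓝[>] 0) (𝓝 0) := by
  have hc := continuous_integral_halfPlanePoisson_smul hg hB
  have hcy : ∀ y : ℝ, Continuous fun x : ℝ =>
      (∫ s, halfPlanePoisson 1 s • g (x - y * s)) := fun y =>
    hc.comp (continuous_id.prodMk continuous_const)
  have hcx : ∀ x : ℝ, Continuous fun y : ℝ =>
      (∫ s, halfPlanePoisson 1 s • g (x - y * s)) := fun x =>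
    hc.comp (continuous_const.prodMk continuous_id)
  have h0 : ∀ x : ℝ, (∫ s, halfPlanePoisson 1 s • g (x - 0 * s)) = g x := fun x => by
    simp only [zero_mul, sub_zero]
    rw [integral_smul_const, integral_halfPlanePoisson_one, one_smul]
  have hlim := tendsto_lintegral_filter_of_dominated_convergence (μ := harmonicMeasure 0 1)
    (l := 𝓝[>] (0 : ℝ)) (f := fun _ => 0)
    (F := fun y x => ‖(∫ s, halfPlanePoisson 1 s • g (x - y * s)) - g x‖ₑ)
    (fun _ => ENNReal.ofReal (B + B)) (Eventually.of_forall fun y => ?_)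
    (Eventually.of_forall fun y => ae_of_all _ fun x => ?_) ?_ (ae_of_all _ fun x => ?_)
  · simpa using hlim
  · exact ((hcy y).sub hg).measurable.enorm
  · rw [← ofReal_norm]
    exact ENNReal.ofReal_le_ofReal ((norm_sub_le _ _).trans
      (add_le_add (norm_integral_halfPlanePoisson_smul_le hB x y) (hB x)))
  · simp
  · have : Tendsto (fun y : ℝ => ‖(∫ s, halfPlanePoisson 1 s • g (x - y * s)) - g x‖ₑ) (𝓝 0)
        (𝓝 ‖(∫ s, halfPlanePoisson 1 s • g (x - 0 * s)) - g x‖ₑ) :=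
      (((hcx x).tendsto 0).sub_const _).enorm
    rw [h0, sub_self, enorm_zero] at this
    exact this.mono_left nhdsWithin_le_nhds

/-- The Poisson integral of `f` converges to `f` in `L¹` of the reference measure. -/
theorem tendsto_lintegral_enorm_integral_harmonicMeasure_sub {f : ℝ → ℂ}
    (hf : Integrable f (harmonicMeasure 0 1)) :
    Tendsto (fun y => ∫⁻ x, ‖(∫ t, f t ∂harmonicMeasure x y) - f x‖ₑ ∂harmonicMeasure 0 1)
      (𝓝[>] 0) (𝓝 0) := by
  rw [ENNReal.tendsto_nhds_zero]
  intro ε hε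
  obtain ⟨g, hfg, hgi⟩ := (memLp_one_iff_integrable.2 hf).exists_boundedContinuous_eLpNorm_sub_le
    ENNReal.one_ne_top (ε := ε / 4) (ENNReal.div_pos hε.ne' (by simp)).ne'
  rw [eLpNorm_one_eq_lintegral_enorm] at hfg
  rw [memLp_one_iff_integrable] at hgi
  have hB : ∀ t, ‖g t‖ ≤ ‖g‖ := g.norm_coe_le_norm
  have hlim := ENNReal.tendsto_nhds_zero.1
    (tendsto_lintegral_enorm_sub_of_continuous g.continuous hB) (ε / 4)
    (ENNReal.div_pos hε.ne' (by simp))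
  have hfgm : AEMeasurable (fun t => ‖f t - g t‖ₑ) :=
    ((hf.sub hgi).1.mono_ac (volume_absolutelyContinuous_harmonicMeasure one_pos 0)).enorm
  have hy1 : ∀ᶠ y : ℝ in 𝓝[>] 0, y < 1 :=
    nhdsWithin_le_nhds (Iio_mem_nhds one_pos)
  filter_upwards [hlim, self_mem_nhdsWithin, hy1] with y hyl (hy0 : 0 < y) hy1
  set P : ℝ → ℂ := fun x => ∫ s, halfPlanePoisson 1 s • g (x - y * s) with hP
  have hPc : Continuous P :=
    (continuous_integral_halfPlanePoisson_smul g.continuous hB).comp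
      (continuous_id.prodMk continuous_const)
  have hPeq : ∀ x, P x = ∫ t, g t ∂harmonicMeasure x y := fun x => by
    simp only [hP]
    rw [integral_harmonicMeasure hy0, ← integral_halfPlanePoisson_smul_comp hy0]
    simp only [Complex.real_smul]
  calc ∫⁻ x, ‖(∫ t, f t ∂harmonicMeasure x y) - f x‖ₑ ∂harmonicMeasure 0 1
      ≤ ∫⁻ x, ((∫⁻ t, ‖f t - g t‖ₑ ∂harmonicMeasure x y) + (‖P x - g x‖ₑ + ‖f x - g x‖ₑ))
          ∂harmonicMeasure 0 1 := by
        refine lintegral_mono fun x => ?_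
        have e : (∫ t, f t ∂harmonicMeasure x y) - f x =
            (∫ t, (f t - g t) ∂harmonicMeasure x y) + ((P x - g x) - (f x - g x)) := by
          rw [integral_sub (integrable_harmonicMeasure hf hy0 x)
            (integrable_harmonicMeasure hgi hy0 x), hPeq]
          ring
        rw [e]
        exact (enorm_add_le _ _).trans (add_le_add (enorm_integral_le_lintegral_enorm _)
          enorm_sub_le)
    _ = (∫⁻ x, ∫⁻ t, ‖f t - g t‖ₑ ∂harmonicMeasure x y ∂harmonicMeasure 0 1) +
          ((∫⁻ x, ‖P x - g x‖ₑ ∂harmonicMeasure 0 1) +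
            ∫⁻ x, ‖f x - g x‖ₑ ∂harmonicMeasure 0 1) := by
        have h1 : Measurable fun x => ‖P x - g x‖ₑ := (hPc.sub g.continuous).measurable.enorm
        have h2 := hfgm.mono_ac (harmonicMeasure_absolutelyContinuous 0 1)
        have h3 : AEMeasurable (fun x => ‖P x - g x‖ₑ + ‖f x - g x‖ₑ) (harmonicMeasure 0 1) :=
          h1.aemeasurable.add h2
        rw [lintegral_add_right' _ h3, lintegral_add_left h1]
    _ ≤ 2 * (ε / 4) + (ε / 4 + ε / 4) := by
        refine add_le_add ((lintegral_lintegral_harmonicMeasure_le hfgm hy0).trans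
          (mul_le_mul' ?_ hfg)) (add_le_add hyl hfg)
        rw [← ENNReal.ofReal_ofNat]
        exact ENNReal.ofReal_le_ofReal (by linarith)
    _ = ε := by
        rw [← two_mul, ← add_mul, show (2 + 2 : ℝ≥0∞) = 4 by norm_num]
        exact ENNReal.mul_div_cancel (by simp) (by simp)

lemma continuous_horizontalSlice {F : ℂ → ℂ}
    (hF : InnerProductSpace.HarmonicOnNhd F {z : ℂ | 0 < z.im}) {y : ℝ} (hy : 0 < y) :
    Continuous (horizontalSlice F y) :=
  hF.contDiffOn.continuousOn.comp_continuous (by fun_prop) fun x => by simpa using hy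

lemma IsPoissonIntegral.tendsto_lintegral_enorm_sub {f : ℝ → ℂ} {F : ℂ → ℂ}
    (h : IsPoissonIntegral f F) :
    Tendsto (fun y => ∫⁻ x, ‖horizontalSlice F y x - f x‖ₑ ∂harmonicMeasure 0 1) (𝓝[>] 0)
      (𝓝 0) := by
  refine (tendsto_lintegral_enorm_integral_harmonicMeasure_sub (h.integrable one_pos 0)).congr' ?_
  filter_upwards [self_mem_nhdsWithin] with y (hy : 0 < y)
  simp_rw [h.horizontalSlice_eq hy]

/-- A Poisson integral determines its boundary function. -/
theorem IsPoissonIntegral.ae_eq {f g : ℝ → ℂ} {F : ℂ → ℂ}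
    (hF : InnerProductSpace.HarmonicOnNhd F {z : ℂ | 0 < z.im}) (hf : IsPoissonIntegral f F)
    (hg : IsPoissonIntegral g F) : f =ᵐ[volume] g := by
  have hfi := hf.integrable one_pos 0
  have hgi := hg.integrable one_pos 0
  have hzero : ∫⁻ x, ‖f x - g x‖ₑ ∂harmonicMeasure 0 1 ≤ 0 := by
    have hsum := hf.tendsto_lintegral_enorm_sub.add hg.tendsto_lintegral_enorm_sub
    rw [add_zero] at hsum
    refine ge_of_tendsto hsum ?_
    filter_upwards [self_mem_nhdsWithin] with y (hy : 0 < y)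
    have hm : AEMeasurable (fun x => ‖horizontalSlice F y x - f x‖ₑ) (harmonicMeasure 0 1) :=
      ((continuous_horizontalSlice hF hy).aestronglyMeasurable.sub hfi.1).enorm
    rw [← lintegral_add_left' hm]
    refine lintegral_mono fun x => ?_
    have e : f x - g x = (horizontalSlice F y x - g x) - (horizontalSlice F y x - f x) := by ring
    rw [e, add_comm]
    exact enorm_sub_le
  have hm : AEMeasurable (fun x => ‖f x - g x‖ₑ) (harmonicMeasure 0 1) := (hfi.sub hgi).1.enorm
  rw [nonpos_iff_eq_zero, lintegral_eq_zero_iff' hm] at hzero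
  have h := (volume_absolutelyContinuous_harmonicMeasure one_pos 0).ae_le hzero
  filter_upwards [h] with x hx
  simpa [sub_eq_zero] using hx

/-- Along every sequence of heights tending to `0` some subsequence of the horizontal slices
converges almost everywhere to the boundary function. -/
theorem IsPoissonIntegral.exists_subseq_tendsto_ae {f : ℝ → ℂ} {F : ℂ → ℂ}
    (hF : InnerProductSpace.HarmonicOnNhd F {z : ℂ | 0 < z.im}) (hf : IsPoissonIntegral f F)
    {u : ℕ → ℝ} (hu0 : ∀ n, 0 < u n) (hu : Tendsto u atTop (𝓝[>] 0)) :
    ∃ ms : ℕ → ℕ, ∀ᵐ x, Tendsto (fun n => horizontalSlice F (u (ms n)) x) atTop (𝓝 (f x)) := by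
  have hL1 : Tendsto (fun n => eLpNorm (horizontalSlice F (u n) - f) 1 (harmonicMeasure 0 1)) atTop
      (𝓝 0) := by
    simp_rw [eLpNorm_one_eq_lintegral_enorm]
    exact hf.tendsto_lintegral_enorm_sub.comp hu
  obtain ⟨ms, -, hms⟩ := (tendstoInMeasure_of_tendsto_eLpNorm one_ne_zero
    (fun n => (continuous_horizontalSlice hF (hu0 n)).aestronglyMeasurable)
    (hf.integrable one_pos 0).1 hL1).exists_seq_tendsto_ae
  exact ⟨ms, (volume_absolutelyContinuous_harmonicMeasure one_pos 0).ae_le hms⟩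

/-! ### The Luxemburg norm -/

lemma luxNorm_le_of_lintegral_le {Φ : ℝ → ℝ} {f : ℝ → ℂ} {r : ℝ} (hr : 0 < r)
    (h : ∫⁻ x, ENNReal.ofReal (Φ (‖f x‖ / r)) ≤ 1) : luxNorm Φ f ≤ ENNReal.ofReal r :=
  iInf_le_of_le r (iInf_le_of_le hr (iInf_le _ h))

lemma lintegral_le_of_luxNorm_lt {Φ : ℝ → ℝ} (hΦ : IsNFunction Φ) {f : ℝ → ℂ} {r : ℝ}
    (h : luxNorm Φ f < ENNReal.ofReal r) : ∫⁻ x, ENNReal.ofReal (Φ (‖f x‖ / r)) ≤ 1 := by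
  simp only [luxNorm, iInf_lt_iff] at h
  obtain ⟨s, hs, hs1, hsr⟩ := h
  have hsr' : s < r := (ENNReal.ofReal_lt_ofReal_iff_of_nonneg hs.le).1 hsr
  refine (lintegral_mono fun x => ENNReal.ofReal_le_ofReal ?_).trans hs1
  exact hΦ.mono (div_nonneg (norm_nonneg _) (hs.trans hsr').le) (by gcongr)

lemma luxNorm_le_iff {Φ : ℝ → ℝ} (hΦ : IsNFunction Φ) {f : ℝ → ℂ} {a : ℝ≥0∞} :
    luxNorm Φ f ≤ a ↔ ∀ r : ℝ, a < ENNReal.ofReal r →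
      ∫⁻ x, ENNReal.ofReal (Φ (‖f x‖ / r)) ≤ 1 := by
  refine ⟨fun h r hr => lintegral_le_of_luxNorm_lt hΦ (h.trans_lt hr), fun h => ?_⟩
  refine le_of_forall_gt_imp_ge_of_dense fun b hb => ?_
  obtain ⟨c, hac, hcb⟩ := exists_between hb
  have hc : ENNReal.ofReal c.toReal = c := ENNReal.ofReal_toReal (hcb.trans_le le_top).ne
  have hc0 : 0 < c.toReal := ENNReal.toReal_pos (zero_le.trans_lt hac).ne' (hcb.trans_le le_top).ne
  have := luxNorm_le_of_lintegral_le hc0 (h c.toReal (by rwa [hc]))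
  exact this.trans (hc.trans_le hcb.le)

/-- Lower semicontinuity of the Luxemburg norm under almost everywhere convergence. -/
lemma luxNorm_le_of_tendsto_ae {Φ : ℝ → ℝ} (hΦ : IsNFunction Φ) {f : ℝ → ℂ} {g : ℕ → ℝ → ℂ}
    {a : ℝ≥0∞} (hg : ∀ n, Measurable (g n)) (hga : ∀ n, luxNorm Φ (g n) ≤ a)
    (hlim : ∀ᵐ x, Tendsto (fun n => g n x) atTop (𝓝 (f x))) : luxNorm Φ f ≤ a := by
  rw [luxNorm_le_iff hΦ]
  intro r hr
  have hr0 : 0 < r := ENNReal.ofReal_pos.1 (zero_le.trans_lt hr)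
  calc ∫⁻ x, ENNReal.ofReal (Φ (‖f x‖ / r))
      = ∫⁻ x, liminf (fun n => ENNReal.ofReal (Φ (‖g n x‖ / r))) atTop := by
        refine lintegral_congr_ae ?_
        filter_upwards [hlim] with x hx
        exact (((ENNReal.continuous_ofReal.comp
          (hΦ.continuous_comp_norm_div hr0)).tendsto (f x)).comp hx).liminf_eq.symm
    _ ≤ liminf (fun n => ∫⁻ x, ENNReal.ofReal (Φ (‖g n x‖ / r))) atTop :=
        lintegral_liminf_le fun n => (hΦ.measurable_ofReal_comp hr0).comp (hg n)
    _ ≤ liminf (fun _ => 1) atTop :=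
        liminf_le_liminf (Eventually.of_forall fun n => (luxNorm_le_iff hΦ).1 (hga n) r hr)
    _ = 1 := liminf_const 1

/-- Jensen's inequality for `z ↦ Φ(|z|/r)`, without an integrability assumption on the right-hand
side. -/
lemma ofReal_comp_integral_le_lintegral {Φ : ℝ → ℝ} (hΦ : IsNFunction Φ) {r : ℝ} (hr : 0 < r)
    {P : Measure ℝ} [IsProbabilityMeasure P] {f : ℝ → ℂ} (hf : Integrable f P) :
    ENNReal.ofReal (Φ (‖∫ t, f t ∂P‖ / r)) ≤ ∫⁻ t, ENNReal.ofReal (Φ (‖f t‖ / r)) ∂P := by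
  have h0 : ∀ z : ℂ, 0 ≤ Φ (‖z‖ / r) := fun z => hΦ.nonneg (div_nonneg (norm_nonneg z) hr.le)
  have hc := hΦ.continuous_comp_norm_div hr
  have hm : AEStronglyMeasurable (fun t => Φ (‖f t‖ / r)) P := hc.comp_aestronglyMeasurable hf.1
  by_cases htop : ∫⁻ t, ENNReal.ofReal (Φ (‖f t‖ / r)) ∂P = ∞
  · rw [htop]
    exact le_top
  have hi : Integrable (fun t => Φ (‖f t‖ / r)) P :=
    (lintegral_ofReal_ne_top_iff_integrable hm (ae_of_all _ fun t => h0 _)).1 htop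
  rw [← ofReal_integral_eq_lintegral_ofReal hi (ae_of_all _ fun t => h0 _)]
  exact ENNReal.ofReal_le_ofReal ((hΦ.convexOn_comp_norm_div hr).map_integral_le hc.continuousOn
    isClosed_univ (ae_of_all _ fun _ => Set.mem_univ _) hf hi)

/-- Poisson averaging does not increase the Luxemburg norm: Jensen's inequality and Tonelli. -/
theorem IsPoissonIntegral.luxNorm_horizontalSlice_le {Φ : ℝ → ℝ} (hΦ : IsNFunction Φ) {f : ℝ → ℂ}
    {F : ℂ → ℂ} (hf : IsPoissonIntegral f F) {y : ℝ} (hy : 0 < y) :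
    luxNorm Φ (horizontalSlice F y) ≤ luxNorm Φ f := by
  rw [luxNorm_le_iff hΦ]
  intro r hr
  have hr0 : 0 < r := ENNReal.ofReal_pos.1 (zero_le.trans_lt hr)
  refine le_trans ?_ (lintegral_le_of_luxNorm_lt hΦ hr)
  have hfm : AEMeasurable f := ((hf.integrable one_pos 0).1.mono_ac
    (volume_absolutelyContinuous_harmonicMeasure one_pos 0)).aemeasurable
  calc ∫⁻ x, ENNReal.ofReal (Φ (‖horizontalSlice F y x‖ / r))
      ≤ ∫⁻ x, 1 * ∫⁻ t, ENNReal.ofReal (Φ (‖f t‖ / r)) ∂harmonicMeasure x y := by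
        refine lintegral_mono fun x => ?_
        have := isProbabilityMeasure_harmonicMeasure hy x
        rw [hf.horizontalSlice_eq hy, one_mul]
        exact ofReal_comp_integral_le_lintegral hΦ hr0 (hf.integrable hy x)
    _ = ∫⁻ t, ENNReal.ofReal (Φ (‖f t‖ / r)) *
          ∫⁻ x, 1 * ENNReal.ofReal (halfPlanePoisson y (x - t)) :=
        lintegral_lintegral_harmonicMeasure_swap measurable_const
          ((hΦ.measurable_ofReal_comp hr0).comp_aemeasurable hfm) y
    _ = ∫⁻ t, ENNReal.ofReal (Φ (‖f t‖ / r)) := by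
        refine lintegral_congr fun t => ?_
        simp_rw [one_mul, ← neg_sub t _, halfPlanePoisson_neg]
        rw [lintegral_halfPlanePoisson hy, mul_one]

theorem IsPoissonIntegral.hardyNorm_le {Φ : ℝ → ℝ} (hΦ : IsNFunction Φ) {f : ℝ → ℂ}
    {F : ℂ → ℂ} (hf : IsPoissonIntegral f F) : hardyNorm Φ F ≤ luxNorm Φ f :=
  iSup₂_le fun _ hy => hf.luxNorm_horizontalSlice_le hΦ hy

/-- Fatou's lemma for the boundary values: the norm of `f` is at most the lower limit of the norms
of the slices. -/
theorem IsPoissonIntegral.luxNorm_le_of_frequently {Φ : ℝ → ℝ} (hΦ : IsNFunction Φ) {f : ℝ → ℂ}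
    {F : ℂ → ℂ} (hF : InnerProductSpace.HarmonicOnNhd F {z : ℂ | 0 < z.im})
    (hf : IsPoissonIntegral f F) {a : ℝ≥0∞}
    (ha : ∃ᶠ y in 𝓝[>] (0 : ℝ), luxNorm Φ (horizontalSlice F y) ≤ a) : luxNorm Φ f ≤ a := by
  obtain ⟨u, hu, hua⟩ := exists_seq_forall_of_frequently
    (ha.and_eventually (self_mem_nhdsWithin : Set.Ioi (0 : ℝ) ∈ 𝓝[>] 0))
  obtain ⟨ms, hms⟩ := hf.exists_subseq_tendsto_ae hF (fun n => (hua n).2) hu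
  exact luxNorm_le_of_tendsto_ae hΦ
    (fun n => (continuous_horizontalSlice hF (hua (ms n)).2).measurable)
    (fun n => (hua (ms n)).1) hms

theorem IsPoissonIntegral.hardyNorm_eq {Φ : ℝ → ℝ} (hΦ : IsNFunction Φ) {f : ℝ → ℂ}
    {F : ℂ → ℂ} (hF : InnerProductSpace.HarmonicOnNhd F {z : ℂ | 0 < z.im})
    (hf : IsPoissonIntegral f F) : hardyNorm Φ F = luxNorm Φ f := by
  refine le_antisymm (hf.hardyNorm_le hΦ) (hf.luxNorm_le_of_frequently hΦ hF ?_)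
  refine Eventually.frequently ?_
  filter_upwards [self_mem_nhdsWithin] with y (hy : 0 < y)
  exact le_iSup₂ (f := fun y (_ : 0 < y) => luxNorm Φ (horizontalSlice F y)) y hy

theorem IsPoissonIntegral.tendsto_luxNorm {Φ : ℝ → ℝ} (hΦ : IsNFunction Φ) {f : ℝ → ℂ}
    {F : ℂ → ℂ} (hF : InnerProductSpace.HarmonicOnNhd F {z : ℂ | 0 < z.im})
    (hf : IsPoissonIntegral f F) :
    Tendsto (fun y => luxNorm Φ (horizontalSlice F y)) (𝓝[>] 0) (𝓝 (luxNorm Φ f)) := by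
  refine tendsto_order.2 ⟨fun a ha => ?_, fun a ha => ?_⟩
  · by_contra hcon
    rw [not_eventually] at hcon
    exact ha.not_ge (hf.luxNorm_le_of_frequently hΦ hF (hcon.mono fun y hy => not_lt.1 hy))
  · filter_upwards [self_mem_nhdsWithin] with y (hy : 0 < y)
    exact (hf.luxNorm_horizontalSlice_le hΦ hy).trans_lt ha

/-! ### Existence of boundary values -/

/-- A modular bound on the horizontal slices makes them uniformly integrable for the reference
measure. -/
lemma exists_pos_forall_lintegral_enorm_le {Φ : ℝ → ℝ} (hΦ : IsNFunction Φ) {r : ℝ} (hr : 0 < r)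
    {K : ℝ} (hK : 0 < K) : ∃ T : ℝ, 0 < T ∧ ∀ g : ℝ → ℂ,
      ∫⁻ x, ENNReal.ofReal (Φ (‖g x‖ / r)) ≤ 1 → ∀ s,
      ∫⁻ x in s, ‖g x‖ₑ ∂harmonicMeasure 0 1 ≤
        ENNReal.ofReal (T * (harmonicMeasure 0 1).real s + K) := by
  obtain ⟨T, hT0, hT⟩ := hΦ.exists_lintegral_enorm_le hr hK
  refine ⟨T, hT0, fun g hg s => (hT _ g).trans ?_⟩
  rw [Measure.restrict_apply_univ, ENNReal.ofReal_add (by positivity) hK.le,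
    ENNReal.ofReal_mul hT0.le, ofReal_measureReal]
  refine add_le_add le_rfl (mul_le_of_le_one_right' ?_)
  exact (lintegral_mono' (Measure.restrict_le_self.trans harmonicMeasure_le_volume) le_rfl).trans hg

/-- A function in `h^Φ` is a Poisson integral. The boundary function is a weak limit of slices in
`L¹` of harmonic measure; that it lies in `L^Φ` follows afterwards from Fatou's lemma. -/
theorem exists_isPoissonIntegral {Φ : ℝ → ℝ} (hΦ : IsNFunction Φ) {F : ℂ → ℂ}
    (hF : InnerProductSpace.HarmonicOnNhd F {z : ℂ | 0 < z.im}) (hfin : hardyNorm Φ F < ∞) :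
    ∃ f : ℝ → ℂ, AEStronglyMeasurable f volume ∧ IsPoissonIntegral f F := by
  -- Any finite `r` above the norm will do: every slice then has modular at most `1` at scale `r`.
  set r := (hardyNorm Φ F).toReal + 1
  have hr : 0 < r := by positivity
  have hmod : ∀ y, 0 < y → ∫⁻ x, ENNReal.ofReal (Φ (‖horizontalSlice F y x‖ / r)) ≤ 1 := by
    intro y hy
    refine lintegral_le_of_luxNorm_lt hΦ (lt_of_le_of_lt
      (le_iSup₂ (f := fun y (_ : 0 < y) => luxNorm Φ (horizontalSlice F y)) y hy) ?_)
    change hardyNorm Φ F < _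
    rw [ENNReal.lt_ofReal_iff_toReal_lt hfin.ne]
    exact lt_add_one _
  set u : ℕ → ℝ := fun n => 1 / ((n : ℝ) + 1) with hu
  have hu0 : ∀ n, 0 < u n := fun n => by positivity
  have hulim : Tendsto u atTop (𝓝 0) := tendsto_one_div_add_atTop_nhds_zero_nat
  set g : ℕ → ℝ → ℂ := fun n => horizontalSlice F (u n) with hg
  have hbound : ∀ n, ∃ B : ℝ, ∀ z : ℂ, u n ≤ z.im → ‖F z‖ ≤ B := fun n =>
    exists_bound_of_lintegral_le hΦ hF hr hmod (hu0 n)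
  have hint : ∀ n, Integrable (g n) (harmonicMeasure 0 1) := fun n => by
    obtain ⟨B, hB⟩ := hbound n
    exact Integrable.of_bound (continuous_horizontalSlice hF (hu0 n)).aestronglyMeasurable B
      (ae_of_all _ fun x => hB _ (by simp))
  obtain ⟨T₁, hT₁0, hT₁⟩ := exists_pos_forall_lintegral_enorm_le hΦ hr one_pos
  have hnorm : ∀ n, ∫ x, ‖g n x‖ ∂harmonicMeasure 0 1 ≤ T₁ + 1 := fun n => by
    have h1 := hT₁ (g n) (hmod _ (hu0 n)) Set.univ
    rw [Measure.restrict_univ, probReal_univ, mul_one] at h1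
    rw [integral_norm_eq_lintegral_enorm (hint n).1]
    exact ENNReal.toReal_le_of_le_ofReal (by positivity) h1
  have hui : ∀ ε > 0, ∃ η > 0, ∀ n s, MeasurableSet s → (harmonicMeasure 0 1).real s < η →
      ‖∫ x in s, g n x ∂harmonicMeasure 0 1‖ ≤ ε := fun ε hε => by
    obtain ⟨T, hT0, hT⟩ := exists_pos_forall_lintegral_enorm_le hΦ hr (half_pos hε)
    refine ⟨ε / (2 * T), by positivity, fun n s _ hsη => ?_⟩
    have h1 := (enorm_integral_le_lintegral_enorm _).trans (hT (g n) (hmod _ (hu0 n)) s)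
    rw [← ofReal_norm, ENNReal.ofReal_le_ofReal_iff (by positivity)] at h1
    have h2 := mul_le_mul_of_nonneg_left hsη.le hT0.le
    have h3 : T * (ε / (2 * T)) = ε / 2 := by field_simp
    linarith
  obtain ⟨f, hf, hfw⟩ := exists_tendsto_integral_smul (hyperfilter ℕ) hint hnorm hui
  refine ⟨f, hf.1.mono_ac (volume_absolutelyContinuous_harmonicMeasure one_pos 0),
    fun x y hy => ⟨(integrable_harmonicMeasure_iff hy).1 (integrable_harmonicMeasure hf hy x), ?_⟩⟩
  -- Test the weak convergence against the bounded ratio of the kernels with poles `x + iy` and `i`.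
  set h : ℝ → ℝ := fun t => halfPlanePoisson y (x - t) / halfPlanePoisson 1 t with hh
  have hhm : Measurable h := by
    have : Measurable fun t : ℝ => halfPlanePoisson 1 t := by fun_prop
    exact Measurable.div (by fun_prop) this
  set R := |x| + y with hR
  have hhb : ∀ t, |h t| ≤ R * (2 + (2 * R ^ 2 + 1) / y ^ 2) := fun t => by
    have hp := halfPlanePoisson_pos one_pos t
    rw [hh, abs_of_pos (div_pos (halfPlanePoisson_pos hy _) hp), div_le_iff₀ hp]
    exact halfPlanePoisson_le_mul_one hy (by linarith) le_rfl (by linarith [abs_nonneg x]) t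
  have hratio : ∀ q : ℝ → ℂ, ∫ t, h t • q t ∂harmonicMeasure 0 1 =
      ∫ t, (halfPlanePoisson y (x - t) : ℂ) * q t := fun q => by
    rw [integral_harmonicMeasure one_pos]
    congr 1 with t
    have hp := (halfPlanePoisson_pos one_pos t).ne'
    rw [zero_sub, halfPlanePoisson_neg, Complex.real_smul, ← mul_assoc, ← Complex.ofReal_mul, hh,
      mul_div_cancel₀ _ hp]
  have h1 := hfw h _ hhm hhb
  simp_rw [hratio] at h1
  have hFn : ∀ n, F (x + (y + u n : ℝ) * Complex.I) =
      ∫ t, (halfPlanePoisson y (x - t) : ℂ) * g n t := fun n => by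
    obtain ⟨B, hB⟩ := hbound n
    rw [eq_integral_halfPlanePoisson_of_bounded hF (hu0 n) hB hy]
    simp only [Complex.real_smul, hg]
  simp_rw [← hFn] at h1
  refine tendsto_nhds_unique ?_ h1
  have hcont : ContinuousAt F (x + y * Complex.I) :=
    hF.contDiffOn.continuousOn.continuousAt
      ((isOpen_lt continuous_const Complex.continuous_im).mem_nhds (by simpa using hy))
  have harg : Tendsto (fun n => (x + (y + u n : ℝ) * Complex.I : ℂ)) atTop
      (𝓝 (x + y * Complex.I)) := by
    have : Continuous fun s : ℝ => (x + (y + s : ℝ) * Complex.I : ℂ) := by fun_prop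
    have h2 := (this.tendsto 0).comp hulim
    rw [add_zero] at h2
    exact h2
  exact (hcont.tendsto.comp harg).mono_left Nat.hyperfilter_le_atTop

end HardyOrlicz

end

theorem mainTheorem1 (Φ : ℝ → ℝ) (hΦ : HardyOrlicz.IsNFunction Φ) (F : ℂ → ℂ)
    (hF : InnerProductSpace.HarmonicOnNhd F {z : ℂ | 0 < z.im}) :
    (F ∈ HardyOrlicz.hardyOrliczSpace Φ ↔
      ∃! f : ℝ →ₘ[volume] ℂ,
        f ∈ HardyOrlicz.orliczSpace Φ ∧ HardyOrlicz.IsPoissonIntegral f F) ∧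
    (∀ f : ℝ →ₘ[volume] ℂ,
      f ∈ HardyOrlicz.orliczSpace Φ → HardyOrlicz.IsPoissonIntegral f F →
        HardyOrlicz.hardyNorm Φ F = HardyOrlicz.luxNorm Φ f ∧
        Tendsto (fun y : ℝ => HardyOrlicz.luxNorm Φ (HardyOrlicz.horizontalSlice F y))
          (𝓝[>] 0) (𝓝 (HardyOrlicz.luxNorm Φ f))) := by
  refine ⟨⟨fun hFh => ?_, fun ⟨f, ⟨hfL, hfP⟩, _⟩ => ?_⟩, fun f _ hfP =>
    ⟨hfP.hardyNorm_eq hΦ hF, hfP.tendsto_luxNorm hΦ hF⟩⟩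
  · have hfin : HardyOrlicz.hardyNorm Φ F < ∞ := hFh.2
    obtain ⟨f₀, hf₀m, hf₀⟩ := HardyOrlicz.exists_isPoissonIntegral hΦ hF hfin
    set f : ℝ →ₘ[volume] ℂ := AEEqFun.mk f₀ hf₀m
    have hae : f =ᵐ[volume] f₀ := AEEqFun.coeFn_mk f₀ hf₀m
    have hf : HardyOrlicz.IsPoissonIntegral f F := fun x y hy => by
      have hae' : (fun t => (HardyOrlicz.halfPlanePoisson y (x - t) : ℂ) * f t) =ᵐ[volume]
          fun t => (HardyOrlicz.halfPlanePoisson y (x - t) : ℂ) * f₀ t := by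
        filter_upwards [hae] with t ht
        rw [ht]
      exact ⟨(hf₀ x y hy).1.congr hae'.symm, (hf₀ x y hy).2.trans (integral_congr_ae hae'.symm)⟩
    refine ⟨f, ⟨?_, hf⟩, fun g hg => AEEqFun.ext (hg.2.ae_eq hF hf)⟩
    change HardyOrlicz.luxNorm Φ f < ∞
    rwa [← hf.hardyNorm_eq hΦ hF]
  · exact ⟨hF, (hfP.hardyNorm_le hΦ).trans_lt hfL⟩
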